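/- **Theorem.** A concept is a function $f:\mathbb R^d\to\{-1,1\}$. For $\rho\ge 0$ let $f^{+\rho}(x)=\sup_{\|z\|_2\le\rho}f(x+z)$ and $f^{-\rho}(x)=\inf_{\|z\|_2\le\rho}f(x+z)$. For a probability distribution $\mathcal D$ on $\mathbb R^d$ and $\sigma\ge 1$, $f$ has $\sigma$-smooth boundary with respect to $\mathcal D$ if $\mathbb E_{x\sim\mathcal D}\big[\tfrac12(f^{+\rho}(x)-f^{-\rho}(x))\big]\le\sigma\rho$ for all $\rho\ge 0$. For $\alpha,\beta,\gamma>0$, $\mathcal D$ is $\gamma$-strictly subexponential with parameters $\alpha,\beta$ if $\Pr_{x\sim\mathcal D}[|w\cdot x|\ge r]\le\alpha\exp(-\beta r^{1+\gamma})$ for every unit vector $w\in\mathbb R^d$ and every $r\ge 0$. A concept $f$ has intrinsic dimension $k$ if there are $F:\mathbb R^k\to\{-1,1\}$ and $W\in\mathbb R^{k\times d}$ with $WW^\top=I_{k\times k}$ such that $f(x)=F(Wx)$ for all $x$. For $\varepsilon\in(0,1)$ and $s\ge 1$, $(\varepsilon,s)$-sandwiching polynomials for $f$ with respect to $\mathcal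 D$ are polynomials $p_{\mathrm{up}},p_{\mathrm{down}}$ on $\mathbb R^d$ with $p_{\mathrm{down}}(x)\le f(x)\le p_{\mathrm{up}}(x)$ for all $x\in\mathbb R^d$ and $(\mathbb E_{x\sim\mathcal D}|p_{\mathrm{up}}(x)-p_{\mathrm{down}}(x)|^s)^{1/s}\le\varepsilon$. The $(\varepsilon,s)$-sandwiching degree of $f$ is the least $\ell$ for which there are such polynomials of degree at most $\ell$, and that of a class $\mathcal F$ is the supremum over $f\in\mathcal F$. There is an absolute constant $c\in\mathbb N$, and for all $\alpha,\beta>0$ there is a constant $C=C(\alpha,\beta)>0$, such that the following holds. Let $0\le k\le d$ be integers, $\sigma\ge1$, $\gamma>0$, let $\mathcal D$ be a probability distribution on $\mathbb R^d$ that is $\gamma$-strictly subexponential with parameters $\alpha,\beta$, and let $\mathcal F$ be a class of concepts on $\mathbb R^d$, each of intrinsic dimension $k$ and with $\sigma$-smooth boundary with respect to $\mathcal D$. Let $\varepsilon\in(0,1)$ and $s\ge1$, and put $$X=\frac{\sigma k^{3/2}s}{(\varepsilon/2)^{s+1}}.$$ Then there are $\ell\in\mathbb N$ and $B>0$ with $$\ell\le\big(C\,X\,(\log(2+X))^c\big)^{1+1/\gamma},\qquad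 \log B\le C\,\ell\,(\log(2+\ell))^c\,(1+\log d)^c$$ (with $\log 0$ read as $0$ when $d=0$) such that the $(\varepsilon,s)$-sandwiching degree of $\mathcal F$ with respect to $\mathcal D$ is at most $\ell$; moreover every $f\in\mathcal F$ has $(\varepsilon,s)$-sandwiching polynomials $p_{\mathrm{up}},p_{\mathrm{down}}$ of degree at most $\ell$ for each of which the sum of the absolute values of the coefficients is at most $B$. -/

import Mathlib

open MeasureTheory
open scoped ENNReal

namespace Sandwich

noncomputable section

/-- Euclidean space `ℝ^d`. -/
abbrev E (d : ℕ) : Type := EuclideanSpace ℝ (Fin d)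

/-- A concept: a function on `ℝ^d` with values in `{-1, 1}`. -/
def IsConcept {d : ℕ} (f : E d → ℝ) : Prop := ∀ x, f x = -1 ∨ f x = 1

/-- The `ρ`-dilation of `f`: supremum over the closed `ρ`-ball around `x`. -/
def dilation {d : ℕ} (f : E d → ℝ) (ρ : ℝ) (x : E d) : ℝ :=
  ⨆ z : Metric.closedBall (0 : E d) ρ, f (x + z)

/-- The `ρ`-erosion of `f`: infimum over the closed `ρ`-ball around `x`. -/
def erosion {d : ℕ} (f : E d → ℝ) (ρ : ℝ) (x : E d) : ℝ :=
  ⨅ z : Metric.closedBall (0 : E d) ρ, f (x + z)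

/-- `f` has `σ`-smooth boundary with respect to `D`. The integrand is non-negative, so its
expectation is taken as a `[0, ∞]`-valued integral, which has no junk value. -/
def HasSmoothBoundary {d : ℕ} (f : E d → ℝ) (D : Measure (E d)) (σ : ℝ) : Prop :=
  ∀ ρ : ℝ, 0 ≤ ρ →
    ∫⁻ x, ENNReal.ofReal ((dilation f ρ x - erosion f ρ x) / 2) ∂D ≤ ENNReal.ofReal (σ * ρ)

/-- `D` is `γ`-strictly subexponential with parameters `α`, `β`. -/
def IsStrictlySubexponential {d : ℕ} (D : Measure (E d)) (γ α β : ℝ) : Prop :=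
  ∀ w : E d, ‖w‖ = 1 → ∀ r : ℝ, 0 ≤ r →
    D {x | r ≤ |inner ℝ w x|} ≤ ENNReal.ofReal (α * Real.exp (-β * r ^ (1 + γ)))

/-- `f` has intrinsic dimension `k`: `f x = G (W x)` for a concept `G` on `ℝ^k` and a
`k × d` matrix `W` with orthonormal rows. -/
def HasIntrinsicDim {d : ℕ} (k : ℕ) (f : E d → ℝ) : Prop :=
  ∃ (G : E k → ℝ) (W : Matrix (Fin k) (Fin d) ℝ),
    IsConcept G ∧ W * W.transpose = 1 ∧ ∀ x : E d, f x = G (WithLp.toLp 2 (W.mulVec x.ofLp))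

/-- The concept class `F` and the distribution `D` on `ℝ^d` form a valid instance. -/
structure IsValidInstance {d : ℕ} (F : Set (E d → ℝ)) (D : Measure (E d))
    (k : ℕ) (σ γ α β : ℝ) : Prop where
  dim_le : k ≤ d
  one_le_sigma : 1 ≤ σ
  gamma_pos : 0 < γ
  concept : ∀ f ∈ F, IsConcept f
  intrinsic : ∀ f ∈ F, HasIntrinsicDim k f
  smooth : ∀ f ∈ F, HasSmoothBoundary f D σ
  tails : IsStrictlySubexponential D γ α β

/-- The value of the polynomial `p` at the point `x`. -/
def evalAt {d : ℕ} (p : MvPolynomial (Fin d) ℝ) (x : E d) : ℝ := MvPolynomial.eval x.ofLp p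

/-- The sum of the absolute values of the coefficients of `p`. -/
def coefSum {d : ℕ} (p : MvPolynomial (Fin d) ℝ) : ℝ := ∑ m ∈ p.support, |p.coeff m|

/-- `pUp` and `pDown` are polynomials of degree at most `ℓ` that `(ε, s)`-sandwich `f`
with respect to `D`. -/
structure IsSandwiching {d : ℕ} (f : E d → ℝ) (D : Measure (E d)) (ε s : ℝ) (ℓ : ℕ)
    (pUp pDown : MvPolynomial (Fin d) ℝ) : Prop where
  degree_up : pUp.totalDegree ≤ ℓ
  degree_down : pDown.totalDegree ≤ ℓ
  below : ∀ x, evalAt pDown x ≤ f x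
  above : ∀ x, f x ≤ evalAt pUp x
  close : eLpNorm (fun x => evalAt pUp x - evalAt pDown x) (ENNReal.ofReal s) D
    ≤ ENNReal.ofReal ε

/-- The `(ε, s)`-sandwiching degree of `f` with respect to `D`: the least `ℓ` for which
sandwiching polynomials of degree at most `ℓ` exist, and `⊤` if there is none. -/
def sandwichingDegree {d : ℕ} (f : E d → ℝ) (D : Measure (E d)) (ε s : ℝ) : ℕ∞ :=
  ⨅ (ℓ : ℕ) (_ : ∃ pUp pDown, IsSandwiching f D ε s ℓ pUp pDown), (ℓ : ℕ∞)

/-- The `(ε, s)`-sandwiching degree of the class `F`: the supremum over its elements. -/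
def classSandwichingDegree {d : ℕ} (F : Set (E d → ℝ)) (D : Measure (E d)) (ε s : ℝ) : ℕ∞ :=
  ⨆ f ∈ F, sandwichingDegree f D ε s

/-- The explicit form of `Õ(x)` with constants `C`, `c`: the quantity `C · x · (log (2 + x))^c`. -/
def softO (C : ℝ) (c : ℕ) (x : ℝ) : ℝ := C * x * Real.log (2 + x) ^ c

end

end Sandwich

/-!
A concept `f x = G (W x)` is squeezed between two Lipschitz functions of `W x`, built from the
thickened indicators of `{G = 1}` and of its complement at distance `ρ ≈ (ε / 2) ^ s / σ`. They
differ only within distance `ρ` of both sides of the concept. As `W` has orthonormal rows,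
displacements of `W x` lift to displacements of `x` of the same length, so the smoothness of the
boundary bounds the measure of that set by `σ ρ` (`measure_boundary_le`), and the `L^s` gap between
the two functions is at most `ε (1 - 1 / (2 s))`. An error of order `ε / s` is left for the
polynomials.

On the cube `[-R, R]^k` both functions are approximated at the Jackson rate
(`exists_cube_approx`). The approximant averages the function over a product of one-dimensional
kernels (`exists_nodes_kernel`): at each point `x` of `[-1, 1]` such a kernel is a probability
vector on the Chebyshev nodes whose mean square distance from `x` is `O(n⁻²)`, and its entries are
polynomials of degree `n` in `x`. It comes from the Fejér–Korovkin trigonometric kernel. The total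
degree is `k n ≈ X R`, where one factor `√k` of `k^{3/2}` comes from the Euclidean distance in the
cube and the factor `k` from the product. The explicit kernel also bounds the coefficients by
`6 ^ (k n)`, hence the values of the polynomials outside the cube.

Adding and subtracting `∑ (6 u_i) ^ (2 k n)`, with `u = W x / R`, makes the inequalities hold
everywhere (`exists_polynomial_pair`). By the strictly subexponential tails the `L^s` norm of this
term is of order `2 ^ (-2 k n)` (`eLpNorm_pow_le`), provided that `R ^ (1 + γ)` exceeds a multiple
of `k n s ≈ X R s`. That leads to `R ≈ (X s) ^ (1 / γ)`, and the degree is of order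
`X R ≤ (X s) ^ (1 + 1 / γ)` up to constants; finally `s ≤ 2 log (2 + X)`, since `X ≥ 2 ^ s`.
-/

namespace Sandwich

/-! ### The coefficient norm of a polynomial -/

section CoefSum

open MvPolynomial

variable {d k : ℕ}

theorem coefSum_nonneg (p : MvPolynomial (Fin d) ℝ) : 0 ≤ coefSum p :=
  Finset.sum_nonneg fun _ _ => abs_nonneg _

/-- The coefficient sum may be taken over any finite set of exponents containing the support. -/
theorem coefSum_eq_sum_of_subset (p : MvPolynomial (Fin d) ℝ) {S : Finset (Fin d →₀ ℕ)}
    (h : p.support ⊆ S) : coefSum p = ∑ m ∈ S, |p.coeff m| :=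
  Finset.sum_subset h fun m _ hm => by simp [notMem_support_iff.mp hm]

theorem coefSum_add_le (p q : MvPolynomial (Fin d) ℝ) :
    coefSum (p + q) ≤ coefSum p + coefSum q := by
  classical
  rw [coefSum_eq_sum_of_subset (p + q) (S := p.support ∪ q.support) support_add,
    coefSum_eq_sum_of_subset p Finset.subset_union_left,
    coefSum_eq_sum_of_subset q Finset.subset_union_right, ← Finset.sum_add_distrib]
  exact Finset.sum_le_sum fun m _ => by simpa using abs_add_le _ _

theorem coefSum_monomial_le (m : Fin d →₀ ℕ) (a : ℝ) : coefSum (monomial m a) ≤ |a| := by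
  classical
  rw [coefSum_eq_sum_of_subset (S := {m}) _ support_monomial_subset]
  simp

theorem coefSum_C_le (a : ℝ) : coefSum (C a : MvPolynomial (Fin d) ℝ) ≤ |a| :=
  coefSum_monomial_le 0 a

theorem coefSum_sum_le {ι : Type*} (S : Finset ι) (p : ι → MvPolynomial (Fin d) ℝ) :
    coefSum (∑ i ∈ S, p i) ≤ ∑ i ∈ S, coefSum (p i) :=
  Finset.le_sum_of_subadditive _ (by simp [coefSum]) coefSum_add_le _ _

theorem coefSum_mul_le (p q : MvPolynomial (Fin d) ℝ) :
    coefSum (p * q) ≤ coefSum p * coefSum q := by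
  have h : p * q = ∑ m ∈ p.support, ∑ m' ∈ q.support,
      monomial (m + m') (p.coeff m * q.coeff m') := by
    conv_lhs => rw [p.as_sum, q.as_sum, Finset.sum_mul_sum]
    simp only [monomial_mul]
  rw [h, coefSum.eq_1 p, coefSum.eq_1 q, Finset.sum_mul_sum]
  refine (coefSum_sum_le _ _).trans (Finset.sum_le_sum fun m _ => ?_)
  refine (coefSum_sum_le _ _).trans (Finset.sum_le_sum fun m' _ => ?_)
  exact (coefSum_monomial_le _ _).trans (abs_mul _ _).le

/-- `SizeLE p n A` says that the polynomial `p` has degree at most `n` and that the absolute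
values of its coefficients sum to at most `A`. -/
def SizeLE (p : MvPolynomial (Fin d) ℝ) (n : ℕ) (A : ℝ) : Prop :=
  p.totalDegree ≤ n ∧ coefSum p ≤ A

namespace SizeLE

variable {p q : MvPolynomial (Fin d) ℝ} {n m : ℕ} {A B : ℝ}

theorem nonneg (hp : SizeLE p n A) : 0 ≤ A := (coefSum_nonneg p).trans hp.2

theorem mono (hp : SizeLE p n A) (hn : n ≤ m) (hA : A ≤ B) : SizeLE p m B :=
  ⟨hp.1.trans hn, hp.2.trans hA⟩

theorem const (a : ℝ) : SizeLE (C a : MvPolynomial (Fin d) ℝ) 0 |a| :=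
  ⟨by simp, coefSum_C_le a⟩

theorem var (i : Fin d) : SizeLE (X i : MvPolynomial (Fin d) ℝ) 1 1 :=
  ⟨by simp, (coefSum_monomial_le (Finsupp.single i 1) 1).trans abs_one.le⟩

theorem add (hp : SizeLE p n A) (hq : SizeLE q n B) : SizeLE (p + q) n (A + B) :=
  ⟨(totalDegree_add p q).trans (max_le hp.1 hq.1),
    (coefSum_add_le p q).trans (add_le_add hp.2 hq.2)⟩

theorem mul (hp : SizeLE p n A) (hq : SizeLE q m B) : SizeLE (p * q) (n + m) (A * B) :=
  ⟨(totalDegree_mul p q).trans (add_le_add hp.1 hq.1),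
    (coefSum_mul_le p q).trans (mul_le_mul hp.2 hq.2 (coefSum_nonneg q) hp.nonneg)⟩

theorem const_mul (a : ℝ) (hp : SizeLE p n A) : SizeLE (C a * p) n (|a| * A) := by
  simpa using (const a).mul hp

theorem neg (hp : SizeLE p n A) : SizeLE (-p) n A := by
  simpa using const_mul (-1) hp

theorem sub (hp : SizeLE p n A) (hq : SizeLE q n B) : SizeLE (p - q) n (A + B) := by
  simpa [sub_eq_add_neg] using hp.add hq.neg

theorem pow (hp : SizeLE p n A) (N : ℕ) : SizeLE (p ^ N) (N * n) (A ^ N) := by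
  induction N with
  | zero => simpa using const (d := d) 1
  | succ N ih => simpa [pow_succ, Nat.succ_mul] using ih.mul hp

theorem sum {ι : Type*} {S : Finset ι} {p : ι → MvPolynomial (Fin d) ℝ} {A : ι → ℝ}
    (h : ∀ i ∈ S, SizeLE (p i) n (A i)) : SizeLE (∑ i ∈ S, p i) n (∑ i ∈ S, A i) :=
  ⟨totalDegree_finsetSum_le fun i hi => (h i hi).1,
    (coefSum_sum_le _ _).trans (Finset.sum_le_sum fun i hi => (h i hi).2)⟩

theorem prod {ι : Type*} {S : Finset ι} {p : ι → MvPolynomial (Fin d) ℝ} {n : ι → ℕ} {A : ι → ℝ}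
    (h : ∀ i ∈ S, SizeLE (p i) (n i) (A i)) :
    SizeLE (∏ i ∈ S, p i) (∑ i ∈ S, n i) (∏ i ∈ S, A i) := by
  classical
  induction S using Finset.induction_on with
  | empty => simpa using const (d := d) 1
  | insert a S ha ih =>
    rw [Finset.prod_insert ha, Finset.sum_insert ha, Finset.prod_insert ha]
    exact (h a (Finset.mem_insert_self _ _)).mul
      (ih fun i hi => h i (Finset.mem_insert_of_mem hi))

/-- Substituting polynomials of degree one and coefficient sum at most `Λ`. -/
theorem bind₁ {P : MvPolynomial (Fin k) ℝ} {g : Fin k → MvPolynomial (Fin d) ℝ} {Λ : ℝ}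
    (hP : SizeLE P n A) (hΛ : 1 ≤ Λ) (hg : ∀ i, SizeLE (g i) 1 Λ) :
    SizeLE (MvPolynomial.bind₁ g P) n (A * Λ ^ n) := by
  have h : MvPolynomial.bind₁ g P = ∑ m ∈ P.support, C (P.coeff m) * ∏ i, g i ^ m i := by
    conv_lhs => rw [P.as_sum, map_sum]
    refine Finset.sum_congr rfl fun m _ => ?_
    rw [bind₁_monomial]
    congr 1
    exact (Finset.prod_subset (Finset.subset_univ _) fun i _ hi => by
      simp [Finsupp.notMem_support_iff.mp hi])
  have hm : ∀ m ∈ P.support, SizeLE (C (P.coeff m) * ∏ i, g i ^ m i) n (|P.coeff m| * Λ ^ n) := by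
    intro m hm
    have hdeg : ∑ i, m i ≤ n := by
      have := (le_totalDegree hm).trans hP.1
      rwa [Finsupp.sum_fintype _ _ (fun _ => rfl)] at this
    refine const_mul _ ((prod fun i _ => (hg i).pow (m i)).mono (by simpa using hdeg) ?_)
    rw [Finset.prod_pow_eq_pow_sum]
    exact pow_le_pow_right₀ hΛ hdeg
  rw [h]
  refine (sum hm).mono le_rfl ?_
  rw [← Finset.sum_mul]
  exact mul_le_mul_of_nonneg_right hP.2 (by positivity)

theorem abs_eval_le {P : MvPolynomial (Fin k) ℝ} (hP : SizeLE P n A) {u : Fin k → ℝ} {M : ℝ}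
    (hM : 1 ≤ M) (hu : ∀ i, |u i| ≤ M) : |MvPolynomial.eval u P| ≤ A * M ^ n := by
  have hm : ∀ m ∈ P.support, |P.coeff m * ∏ i, u i ^ m i| ≤ |P.coeff m| * M ^ n := by
    intro m hm
    have hdeg : ∑ i, m i ≤ n := by
      have := (le_totalDegree hm).trans hP.1
      rwa [Finsupp.sum_fintype _ _ (fun _ => rfl)] at this
    rw [abs_mul, Finset.abs_prod]
    refine mul_le_mul_of_nonneg_left ?_ (abs_nonneg _)
    calc ∏ i, |u i ^ m i| ≤ ∏ i, M ^ m i :=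
          Finset.prod_le_prod (fun i _ => abs_nonneg _) fun i _ => by
            rw [abs_pow]; exact pow_le_pow_left₀ (abs_nonneg _) (hu i) _
      _ = M ^ ∑ i, m i := Finset.prod_pow_eq_pow_sum _ _ _
      _ ≤ M ^ n := pow_le_pow_right₀ hM hdeg
  rw [MvPolynomial.eval_eq']
  refine (Finset.abs_sum_le_sum_abs _ _).trans ((Finset.sum_le_sum hm).trans ?_)
  rw [← Finset.sum_mul]
  exact mul_le_mul_of_nonneg_right hP.2 (by positivity)

end SizeLE

/-- The Chebyshev polynomial `T_m` in one of the variables. -/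
theorem sizeLE_aeval_T (i : Fin k) (m : ℕ) :
    SizeLE (Polynomial.aeval (X i : MvPolynomial (Fin k) ℝ) (Polynomial.Chebyshev.T ℝ m))
      m (3 ^ m) := by
  suffices h : ∀ m : ℕ,
      SizeLE (Polynomial.aeval (X i : MvPolynomial (Fin k) ℝ) (Polynomial.Chebyshev.T ℝ m))
        m (3 ^ m) ∧
      SizeLE (Polynomial.aeval (X i : MvPolynomial (Fin k) ℝ)
        (Polynomial.Chebyshev.T ℝ ((m + 1 : ℕ) : ℤ))) (m + 1) (3 ^ (m + 1)) from (h m).1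
  intro m
  induction m with
  | zero =>
    constructor
    · simpa using SizeLE.const (d := k) 1
    · simpa using (SizeLE.var i).mono le_rfl (by norm_num : (1 : ℝ) ≤ 3)
  | succ m ih =>
    refine ⟨ih.2, ?_⟩
    have h2 := (((SizeLE.var i).mul ih.2).const_mul 2).sub (ih.1.mono (m := 1 + (m + 1))
      (by omega) le_rfl)
    have he : Polynomial.aeval (X i : MvPolynomial (Fin k) ℝ)
        (Polynomial.Chebyshev.T ℝ ((m + 1 + 1 : ℕ) : ℤ)) =
        C 2 * (X i * Polynomial.aeval (X i : MvPolynomial (Fin k) ℝ)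
          (Polynomial.Chebyshev.T ℝ ((m + 1 : ℕ) : ℤ))) -
        Polynomial.aeval (X i : MvPolynomial (Fin k) ℝ) (Polynomial.Chebyshev.T ℝ m) := by
      have := Polynomial.Chebyshev.T_add_two ℝ (m : ℤ)
      push_cast
      rw [show (m : ℤ) + 1 + 1 = m + 2 by ring, this]
      rw [map_sub, map_mul, map_mul, Polynomial.aeval_X, mul_assoc, map_ofNat, map_ofNat]
    rw [he]
    refine h2.mono (by omega) ?_
    have : (0 : ℝ) < 3 ^ m := by positivity
    simp only [abs_two, pow_succ]
    linarith

end CoefSum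

/-! ### A positive kernel of Fejér–Korovkin type on Chebyshev nodes -/

section Kernel

open Polynomial Real Finset

/-- The weights `sin (π a / M)`; they vanish at `a = 0` and `a = M` and satisfy the discrete
eigenvalue equation `w (a + 2) + w a = 2 cos (π / M) w (a + 1)`. -/
noncomputable def weight (M a : ℕ) : ℝ := sin (π * a / M)

/-- The trigonometric kernel `|∑ a < M, w a * exp (i a t)|²`, multiplied out. -/
noncomputable def trigKernel (M : ℕ) (t : ℝ) : ℝ :=
  ∑ a ∈ range M, ∑ b ∈ range M, weight M a * weight M b * cos (((a - b : ℤ) : ℝ) * t)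

/-- The Chebyshev angles `(2 i + 1) π / (2 M)`. -/
noncomputable def angle (M i : ℕ) : ℝ := (2 * i + 1) / (2 * M) * π

theorem trigKernel_nonneg (M : ℕ) (t : ℝ) : 0 ≤ trigKernel M t := by
  have h : trigKernel M t = (∑ a ∈ range M, weight M a * cos (a * t)) ^ 2 +
      (∑ a ∈ range M, weight M a * sin (a * t)) ^ 2 := by
    rw [trigKernel, sq, sq, Finset.sum_mul_sum, Finset.sum_mul_sum, ← Finset.sum_add_distrib]
    refine Finset.sum_congr rfl fun a _ => ?_
    rw [← Finset.sum_add_distrib]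
    refine Finset.sum_congr rfl fun b _ => ?_
    push_cast
    rw [sub_mul, cos_sub]
    ring
  rw [h]
  positivity

theorem sum_cos_angle {M : ℕ} (hM : M ≠ 0) {m : ℤ} (hm : |m| < 2 * M) :
    ∑ i ∈ range M, cos (m * angle M i) = if m = 0 then (M : ℝ) else 0 := by
  split_ifs with h
  · simp [h]
  · have hd : ¬ (2 * M : ℤ) ∣ m := fun hd => h (Int.eq_zero_of_abs_lt_dvd hd hm)
    have h0 := Chebyshev.sumZeroes_T_of_not_dvd hd
    rw [Chebyshev.sumZeroes] at h0
    have hne : π / M ≠ 0 := by positivity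
    simpa [hne, Chebyshev.T_real_cos, angle] using h0

theorem sum_cos_sub_add_angle {M : ℕ} (hM : M ≠ 0) {m : ℤ} (hm : |m| < 2 * M) (θ : ℝ) :
    ∑ i ∈ range M, (cos (m * (θ - angle M i)) + cos (m * (θ + angle M i))) =
      if m = 0 then 2 * (M : ℝ) else 0 := by
  have h : ∀ i, cos (m * (θ - angle M i)) + cos (m * (θ + angle M i)) =
      2 * cos (m * θ) * cos (m * angle M i) := fun i => by
    rw [mul_sub, mul_add, cos_sub, cos_add]; ring
  simp_rw [h]
  rw [← Finset.mul_sum, sum_cos_angle hM hm]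
  split_ifs with h0 <;> simp [h0]

theorem sum_trigKernel {M : ℕ} (hM : M ≠ 0) (θ : ℝ) :
    ∑ i ∈ range M, (trigKernel M (θ - angle M i) + trigKernel M (θ + angle M i)) =
      2 * M * ∑ a ∈ range M, weight M a ^ 2 := by
  simp_rw [trigKernel, ← Finset.sum_add_distrib, ← mul_add]
  rw [Finset.sum_comm, Finset.mul_sum]
  refine Finset.sum_congr rfl fun a ha => ?_
  rw [Finset.sum_comm]
  have ha := Finset.mem_range.mp ha
  have h : ∀ b ∈ range M, ∑ i ∈ range M, weight M a * weight M b *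
      (cos (((a - b : ℤ) : ℝ) * (θ - angle M i)) + cos (((a - b : ℤ) : ℝ) * (θ + angle M i))) =
      if a = b then 2 * M * weight M a ^ 2 else 0 := by
    intro b hb
    have hb := Finset.mem_range.mp hb
    rw [← Finset.mul_sum, sum_cos_sub_add_angle hM (by rw [abs_lt]; omega)]
    by_cases hab : a = b
    · subst hab; simp; ring
    · rw [if_neg hab, if_neg (by omega), mul_zero]
  rw [Finset.sum_congr rfl h]
  simp [ha]

theorem weight_self {M : ℕ} (hM : M ≠ 0) : weight M M = 0 := by
  have : (M : ℝ) ≠ 0 := by positivity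
  rw [weight, mul_div_assoc, div_self this, mul_one, sin_pi]

theorem weight_zero (M : ℕ) : weight M 0 = 0 := by simp [weight]

theorem weight_add_weight (M a : ℕ) :
    weight M (a + 2) + weight M a = 2 * cos (π / M) * weight M (a + 1) := by
  have h1 : π * ((a + 2 : ℕ) : ℝ) / M = π * ((a + 1 : ℕ) : ℝ) / M + π / M := by
    push_cast; ring
  have h2 : π * (a : ℝ) / M = π * ((a + 1 : ℕ) : ℝ) / M - π / M := by
    push_cast; ring
  simp only [weight]
  rw [h1, h2, sin_add, sin_sub]
  ring

theorem sum_weight_mul_weight {M : ℕ} (hM : M ≠ 0) :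
    ∑ a ∈ range M, weight M a * weight M (a + 1) =
      cos (π / M) * ∑ a ∈ range M, weight M a ^ 2 := by
  have h1 : ∑ a ∈ range M, weight M (a + 1) * weight M (a + 2) =
      ∑ a ∈ range M, weight M a * weight M (a + 1) := by
    have := Finset.sum_range_succ' (fun a => weight M a * weight M (a + 1)) M
    rw [Finset.sum_range_succ] at this
    simpa [weight_self hM, weight_zero] using this.symm
  have h2 : ∑ a ∈ range M, weight M (a + 1) ^ 2 = ∑ a ∈ range M, weight M a ^ 2 := by
    have := Finset.sum_range_succ' (fun a => weight M a ^ 2) M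
    rw [Finset.sum_range_succ] at this
    simpa [weight_self hM, weight_zero] using this.symm
  have h3 : ∑ a ∈ range M, weight M (a + 1) * weight M (a + 2) +
      ∑ a ∈ range M, weight M a * weight M (a + 1) =
      2 * (cos (π / M) * ∑ a ∈ range M, weight M (a + 1) ^ 2) := by
    rw [← Finset.sum_add_distrib, Finset.mul_sum, Finset.mul_sum]
    refine Finset.sum_congr rfl fun a _ => ?_
    linear_combination weight M (a + 1) * weight_add_weight M a
  rw [h1, h2] at h3
  linarith

theorem sum_trigKernel_mul_cos {M : ℕ} (hM : 2 ≤ M) (θ : ℝ) :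
    ∑ i ∈ range M, (trigKernel M (θ - angle M i) * cos (θ - angle M i) +
        trigKernel M (θ + angle M i) * cos (θ + angle M i)) =
      2 * M * (cos (π / M) * ∑ a ∈ range M, weight M a ^ 2) := by
  have hM0 : M ≠ 0 := by omega
  have hcos : ∀ (a b : ℕ) (t : ℝ), cos (((a - b : ℤ) : ℝ) * t) * cos t =
      (cos (((a - b + 1 : ℤ) : ℝ) * t) + cos (((a - b - 1 : ℤ) : ℝ) * t)) / 2 := by
    intro a b t
    push_cast
    rw [show ((a : ℝ) - b + 1) * t = (a - b) * t + t by ring,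
      show ((a : ℝ) - b - 1) * t = (a - b) * t - t by ring, cos_add, cos_sub]
    ring
  have hpair : ∀ a ∈ range M, ∀ b ∈ range M, ∑ i ∈ range M,
      (weight M a * weight M b * cos (((a - b : ℤ) : ℝ) * (θ - angle M i)) * cos (θ - angle M i) +
      weight M a * weight M b * cos (((a - b : ℤ) : ℝ) * (θ + angle M i)) * cos (θ + angle M i)) =
      (if b = a + 1 then M * (weight M a * weight M b) else 0) +
      (if a = b + 1 then M * (weight M a * weight M b) else 0) := by
    intro a ha b hb
    have ha := Finset.mem_range.mp ha
    have hb := Finset.mem_range.mp hb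
    have h1 := sum_cos_sub_add_angle hM0 (m := (a - b + 1 : ℤ)) (by rw [abs_lt]; omega) θ
    have h2 := sum_cos_sub_add_angle hM0 (m := (a - b - 1 : ℤ)) (by rw [abs_lt]; omega) θ
    have h3 : ∀ i, weight M a * weight M b * cos (((a - b : ℤ) : ℝ) * (θ - angle M i)) *
          cos (θ - angle M i) +
        weight M a * weight M b * cos (((a - b : ℤ) : ℝ) * (θ + angle M i)) *
          cos (θ + angle M i) =
        weight M a * weight M b / 2 * ((cos (((a - b + 1 : ℤ) : ℝ) * (θ - angle M i)) +
          cos (((a - b + 1 : ℤ) : ℝ) * (θ + angle M i))) +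
          (cos (((a - b - 1 : ℤ) : ℝ) * (θ - angle M i)) +
          cos (((a - b - 1 : ℤ) : ℝ) * (θ + angle M i)))) := by
      intro i
      rw [mul_assoc, mul_assoc (weight M a * weight M b), hcos, hcos]
      ring
    rw [Finset.sum_congr rfl fun i _ => h3 i, ← Finset.mul_sum, Finset.sum_add_distrib, h1, h2]
    have e1 : ((a : ℤ) - b + 1 = 0) ↔ b = a + 1 := by omega
    have e2 : ((a : ℤ) - b - 1 = 0) ↔ a = b + 1 := by omega
    simp only [e1, e2]
    split_ifs <;> ring
  simp_rw [trigKernel, Finset.sum_mul, ← Finset.sum_add_distrib]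
  rw [Finset.sum_comm, Finset.sum_congr rfl fun a ha => by
    rw [Finset.sum_comm, Finset.sum_congr rfl (hpair a ha)]]
  simp_rw [Finset.sum_add_distrib]
  have hstep : ∀ a ∈ range M, ∑ b ∈ range M,
      (if b = a + 1 then M * (weight M a * weight M b) else 0) =
      M * (weight M a * weight M (a + 1)) := by
    intro a ha
    rw [Finset.sum_ite_eq' (range M) (a + 1) fun b => (M : ℝ) * (weight M a * weight M b)]
    split_ifs with h
    · rfl
    · -- the missing term `b = M` has weight zero
      have : a + 1 = M := by simp at ha h; omega
      rw [this, weight_self hM0]; ring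
  rw [Finset.sum_congr rfl hstep, Finset.sum_comm (f := fun a b =>
    if a = b + 1 then (M : ℝ) * (weight M a * weight M b) else 0)]
  have hstep' : ∀ b ∈ range M, ∑ a ∈ range M,
      (if a = b + 1 then M * (weight M a * weight M b) else 0) =
      M * (weight M b * weight M (b + 1)) := fun b hb => by
    rw [← hstep b hb]
    exact Finset.sum_congr rfl fun a _ => by rw [mul_comm (weight M a)]
  rw [Finset.sum_congr rfl hstep', ← Finset.mul_sum]
  rw [sum_weight_mul_weight hM0]
  ring

theorem sum_sq_weight_pos {M : ℕ} (hM : 2 ≤ M) : 0 < ∑ a ∈ range M, weight M a ^ 2 := by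
  refine Finset.sum_pos' (fun _ _ => sq_nonneg _) ⟨1, by simp; omega, ?_⟩
  have : 0 < weight M 1 := by
    have h : (2 : ℝ) ≤ M := by exact_mod_cast hM
    refine sin_pos_of_pos_of_lt_pi (by positivity) ?_
    rw [div_lt_iff₀ (by positivity)]
    push_cast
    nlinarith [pi_pos]
  positivity

/-- The algebraic kernel attached to the `i`-th Chebyshev node: the even part of
`trigKernel M (θ - angle M i)`, written as a polynomial in `cos θ` and normalised. -/
noncomputable def nodePoly (M i : ℕ) : ℝ[X] :=
  C ((M * ∑ a ∈ range M, weight M a ^ 2)⁻¹) * ∑ a ∈ range M, ∑ b ∈ range M,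
    C (weight M a * weight M b * cos (((a - b : ℤ) : ℝ) * angle M i)) * Chebyshev.T ℝ (a - b : ℤ)

theorem eval_nodePoly (M i : ℕ) (θ : ℝ) :
    (nodePoly M i).eval (cos θ) = (2 * M * ∑ a ∈ range M, weight M a ^ 2)⁻¹ *
      (trigKernel M (θ - angle M i) + trigKernel M (θ + angle M i)) := by
  have h : ∑ a ∈ range M, ∑ b ∈ range M,
      weight M a * weight M b * cos (((a - b : ℤ) : ℝ) * angle M i) * cos (((a - b : ℤ) : ℝ) * θ) =
      (trigKernel M (θ - angle M i) + trigKernel M (θ + angle M i)) / 2 := by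
    rw [trigKernel, trigKernel, ← Finset.sum_add_distrib, Finset.sum_div]
    refine Finset.sum_congr rfl fun a _ => ?_
    rw [← Finset.sum_add_distrib, Finset.sum_div]
    refine Finset.sum_congr rfl fun b _ => ?_
    rw [mul_sub, mul_add, cos_sub, cos_add]
    ring
  rw [nodePoly, eval_mul, eval_C, eval_finsetSum]
  simp_rw [eval_finsetSum, eval_mul, eval_C, Chebyshev.T_real_cos]
  rw [h, mul_assoc 2, mul_inv 2]
  ring

theorem sizeLE_aeval_nodePoly {n : ℕ} (hn : 1 ≤ n) (i : ℕ) {k : ℕ} (v : Fin k) :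
    SizeLE (aeval (MvPolynomial.X v : MvPolynomial (Fin k) ℝ) (nodePoly (n + 1) i)) n
      (3 ^ n) := by
  set S := ∑ a ∈ range (n + 1), weight (n + 1) a ^ 2 with hS
  have hSpos : 0 < S := sum_sq_weight_pos (by omega)
  have hT : ∀ a ∈ range (n + 1), ∀ b ∈ range (n + 1),
      SizeLE (aeval (MvPolynomial.X v : MvPolynomial (Fin k) ℝ)
        (C (weight (n + 1) a * weight (n + 1) b * cos (((a - b : ℤ) : ℝ) * angle (n + 1) i)) *
          Chebyshev.T ℝ (a - b : ℤ))) n (|weight (n + 1) a| * |weight (n + 1) b| * 3 ^ n) := by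
    intro a ha b hb
    have hab : (a - b : ℤ).natAbs ≤ n := by simp at ha hb; omega
    have h1 := sizeLE_aeval_T v (a - b : ℤ).natAbs
    rw [Chebyshev.T_natAbs] at h1
    rw [map_mul, aeval_C]
    refine (h1.const_mul _).mono hab ?_
    rw [abs_mul, abs_mul]
    have hc := abs_cos_le_one (((a - b : ℤ) : ℝ) * angle (n + 1) i)
    have h3 : (3 : ℝ) ^ (a - b : ℤ).natAbs ≤ 3 ^ n := pow_le_pow_right₀ (by norm_num) hab
    calc _ ≤ |weight (n + 1) a| * |weight (n + 1) b| * 1 * 3 ^ n := by gcongr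
      _ = _ := by ring
  have hsum := (SizeLE.sum fun a ha => SizeLE.sum (hT a ha)).const_mul
    ((((n + 1 : ℕ) : ℝ) * S)⁻¹)
  rw [nodePoly, map_mul, aeval_C, map_sum]
  simp_rw [map_sum]
  refine hsum.mono le_rfl ?_
  simp_rw [← Finset.sum_mul, ← Finset.mul_sum, ← Finset.sum_mul]
  -- Cauchy–Schwarz for the weights cancels the normalising factor
  have hcs : (∑ a ∈ range (n + 1), |weight (n + 1) a|) *
      (∑ a ∈ range (n + 1), |weight (n + 1) a|) ≤ ((n + 1 : ℕ) : ℝ) * S := by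
    have := sq_sum_le_card_mul_sum_sq (s := range (n + 1)) (f := fun a => |weight (n + 1) a|)
    simpa [sq_abs, sq, hS] using this
  have hpos : 0 < ((n + 1 : ℕ) : ℝ) * S := by positivity
  rw [abs_of_pos (inv_pos.mpr hpos), ← mul_assoc]
  refine mul_le_of_le_one_left (by positivity) ?_
  rw [inv_mul_le_iff₀ hpos, mul_one]
  exact hcs

theorem sq_cos_sub_cos_le (θ φ : ℝ) : (cos θ - cos φ) ^ 2 ≤ 2 * (1 - cos (θ - φ)) := by
  rw [cos_sub]
  nlinarith [sin_sq_add_cos_sq θ, sin_sq_add_cos_sq φ, sq_nonneg (sin θ - sin φ)]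

/-- A positive linear approximation scheme of degree `n` on `[-1, 1]`, given by finitely many nodes
`y j` and polynomials `κ j`, which is a probability vector at each point `x ∈ [-1, 1]`, centred
near `x` with mean square deviation `O(n⁻²)`. -/
theorem exists_nodes_kernel {n : ℕ} (hn : 1 ≤ n) :
    ∃ (y : Fin (n + 1) → ℝ) (κ : Fin (n + 1) → ℝ[X]), (∀ j, |y j| ≤ 1) ∧
      (∀ (k : ℕ) (v : Fin k) (j), SizeLE (aeval (MvPolynomial.X v : MvPolynomial (Fin k) ℝ) (κ j))
        n (3 ^ n)) ∧
      ∀ x : ℝ, |x| ≤ 1 → (∀ j, 0 ≤ (κ j).eval x) ∧ ∑ j, (κ j).eval x = 1 ∧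
        ∑ j, (κ j).eval x * (x - y j) ^ 2 ≤ (4 / n) ^ 2 := by
  refine ⟨fun j => cos (angle (n + 1) j), fun j => nodePoly (n + 1) j,
    fun j => abs_cos_le_one _, fun k v j => sizeLE_aeval_nodePoly hn j v, fun x hx => ?_⟩
  obtain ⟨θ, rfl⟩ : ∃ θ, cos θ = x :=
    ⟨arccos x, cos_arccos (neg_le_of_abs_le hx) (le_of_abs_le hx)⟩
  set M := n + 1 with hM
  set S := ∑ a ∈ range M, weight M a ^ 2 with hS
  have hSpos : 0 < S := sum_sq_weight_pos (by omega)
  have hMpos : (0 : ℝ) < M := by positivity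
  refine ⟨fun j => ?_, ?_, ?_⟩
  · rw [eval_nodePoly]
    have h1 := trigKernel_nonneg M (θ - angle M j)
    have h2 := trigKernel_nonneg M (θ + angle M j)
    positivity
  · rw [Fin.sum_univ_eq_sum_range (fun j => (nodePoly M j).eval (cos θ))]
    simp_rw [eval_nodePoly]
    rw [← Finset.mul_sum, sum_trigKernel (by omega), ← hS]
    exact inv_mul_cancel₀ (by positivity)
  · rw [Fin.sum_univ_eq_sum_range (fun j => (nodePoly M j).eval (cos θ) *
      (cos θ - cos (angle M j)) ^ 2)]
    have hterm : ∀ j ∈ range M, (nodePoly M j).eval (cos θ) * (cos θ - cos (angle M j)) ^ 2 ≤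
        (2 * M * S)⁻¹ * (2 * (trigKernel M (θ - angle M j) + trigKernel M (θ + angle M j) -
          (trigKernel M (θ - angle M j) * cos (θ - angle M j) +
            trigKernel M (θ + angle M j) * cos (θ + angle M j)))) := by
      intro j _
      rw [eval_nodePoly, mul_assoc]
      refine mul_le_mul_of_nonneg_left ?_ (by positivity)
      have h1 := trigKernel_nonneg M (θ - angle M j)
      have h2 := trigKernel_nonneg M (θ + angle M j)
      have h3 := sq_cos_sub_cos_le θ (angle M j)
      have h4 := sq_cos_sub_cos_le θ (-angle M j)
      rw [cos_neg, sub_neg_eq_add] at h4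
      nlinarith [mul_le_mul_of_nonneg_left h3 h1, mul_le_mul_of_nonneg_left h4 h2]
    refine (Finset.sum_le_sum hterm).trans ?_
    rw [← Finset.mul_sum, ← Finset.mul_sum, Finset.sum_sub_distrib, sum_trigKernel (by omega),
      sum_trigKernel_mul_cos (by omega), ← hS]
    have hval : (2 * M * S)⁻¹ * (2 * (2 * M * S - 2 * M * (cos (π / M) * S))) =
        2 * (1 - cos (π / M)) := by
      field_simp
    rw [hval]
    have hcos := one_sub_sq_div_two_le_cos (x := π / M)
    have hle : π / M ≤ 4 / n := by
      have hn' : (0 : ℝ) < n := by positivity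
      exact div_le_div₀ (by norm_num) pi_le_four hn' (by rw [hM]; push_cast; linarith)
    have : (π / M) ^ 2 ≤ (4 / n) ^ 2 := pow_le_pow_left₀ (by positivity) hle 2
    linarith

end Kernel

/-! ### Jackson's theorem on the cube -/

section Cube

open MvPolynomial

/-- Jackson's theorem on the cube `[-1, 1]^k` for functions that are Lipschitz in the Euclidean
distance. The approximant is the mean of `h` over the product of the one-dimensional kernels, so
that the error is at most `L` times the mean distance of the random node to the point. -/
theorem exists_cube_approx {n k : ℕ} (hn : 1 ≤ n) {h : (Fin k → ℝ) → ℝ} {L : ℝ} (hL : 0 ≤ L)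
    (hb : ∀ u, |h u| ≤ 1) (hlip : ∀ u v, |h u - h v| ≤ L * √(∑ i, (u i - v i) ^ 2)) :
    ∃ Q : MvPolynomial (Fin k) ℝ, SizeLE Q (k * n) (6 ^ (k * n)) ∧
      ∀ u : Fin k → ℝ, (∀ i, |u i| ≤ 1) → |eval u Q - h u| ≤ L * (√k * (4 / n)) := by
  obtain ⟨y, κ, hy, hsize, hκ⟩ := exists_nodes_kernel hn
  refine ⟨∑ j : Fin k → Fin (n + 1), C (h fun i => y (j i)) *
    ∏ i, Polynomial.aeval (X i : MvPolynomial (Fin k) ℝ) (κ (j i)), ?_, fun u hu => ?_⟩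
  · have hterm : ∀ j ∈ (Finset.univ : Finset (Fin k → Fin (n + 1))),
        SizeLE (C (h fun i => y (j i)) *
          ∏ i, Polynomial.aeval (X i : MvPolynomial (Fin k) ℝ) (κ (j i))) (k * n)
          ((3 ^ n) ^ k) := by
      intro j _
      have h1 := (SizeLE.prod (S := Finset.univ) fun i _ => hsize k i (j i)).const_mul
        (h fun i => y (j i))
      refine h1.mono (by simp) ?_
      simpa using mul_le_mul_of_nonneg_right (hb fun i => y (j i))
        (by positivity : (0 : ℝ) ≤ (3 ^ n) ^ k)
    refine (SizeLE.sum hterm).mono le_rfl ?_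
    have h2 : ((n : ℝ) + 1) ≤ 2 ^ n := by exact_mod_cast Nat.lt_two_pow_self (n := n)
    have h3 : ((n : ℝ) + 1) ^ k ≤ (2 ^ n) ^ k := pow_le_pow_left₀ (by positivity) h2 k
    calc ∑ _j : Fin k → Fin (n + 1), ((3 : ℝ) ^ n) ^ k = ((n : ℝ) + 1) ^ k * (3 ^ n) ^ k := by simp
      _ ≤ (2 ^ n) ^ k * (3 ^ n) ^ k := by gcongr
      _ = 6 ^ (k * n) := by
        rw [← mul_pow, ← mul_pow, mul_comm k n, pow_mul]
        norm_num
  · set w : (Fin k → Fin (n + 1)) → ℝ := fun j => ∏ i, (κ (j i)).eval (u i) with hw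
    have hw0 : ∀ j, 0 ≤ w j := fun j => Finset.prod_nonneg fun i _ => (hκ _ (hu i)).1 _
    have hw1 : ∑ j, w j = 1 := by
      rw [hw, ← Fintype.prod_sum fun i j => (κ j).eval (u i)]
      exact Finset.prod_eq_one fun i _ => (hκ _ (hu i)).2.1
    have hw2 : ∀ i, ∑ j, w j * (u i - y (j i)) ^ 2 ≤ (4 / n) ^ 2 := by
      intro i
      have hfac : ∀ j, w j * (u i - y (j i)) ^ 2 =
          ∏ i', (κ (j i')).eval (u i') * (if i' = i then (u i - y (j i')) ^ 2 else 1) := by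
        intro j
        rw [Finset.prod_mul_distrib, Finset.prod_ite_eq' Finset.univ i]
        simp [hw]
      simp_rw [hfac]
      rw [← Fintype.prod_sum fun i' j =>
        (κ j).eval (u i') * (if i' = i then (u i - y j) ^ 2 else 1)]
      rw [← Finset.mul_prod_erase Finset.univ _ (Finset.mem_univ i),
        Finset.prod_eq_one (s := Finset.univ.erase i), mul_one]
      · simpa using (hκ _ (hu i)).2.2
      · intro i' hi'
        simpa [Finset.ne_of_mem_erase hi'] using (hκ _ (hu i')).2.1
    have heval : eval u (∑ j : Fin k → Fin (n + 1), C (h fun i => y (j i)) *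
        ∏ i, Polynomial.aeval (X i : MvPolynomial (Fin k) ℝ) (κ (j i))) =
        ∑ j, w j * h fun i => y (j i) := by
      rw [map_sum]
      refine Finset.sum_congr rfl fun j _ => ?_
      have hi : ∀ i, eval u (Polynomial.aeval (X i : MvPolynomial (Fin k) ℝ) (κ (j i))) =
          (κ (j i)).eval (u i) := fun i => by
        have := Polynomial.aeval_algHom_apply (MvPolynomial.aeval u) (X i) (κ (j i))
        rw [aeval_X] at this
        simpa [MvPolynomial.aeval_eq_eval, Polynomial.aeval_def, Polynomial.eval₂_eq_eval_map]
          using this.symm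
      rw [map_mul, eval_C, map_prod, mul_comm]
      simp_rw [hi, hw]
    set δ : (Fin k → Fin (n + 1)) → ℝ := fun j => √(∑ i, (u i - y (j i)) ^ 2) with hδ
    have hmean : ∑ j, w j * δ j ≤ √k * (4 / n) := by
      have hsq : (∑ j, w j * δ j) ^ 2 ≤ (∑ j, w j) * ∑ j, w j * δ j ^ 2 :=
        Finset.sum_sq_le_sum_mul_sum_of_sq_le_mul _ (fun j _ => hw0 j)
          (fun j _ => mul_nonneg (hw0 j) (sq_nonneg _)) fun j _ => le_of_eq (by ring)
      have hvar : ∑ j, w j * δ j ^ 2 ≤ k * (4 / n) ^ 2 := by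
        have : ∀ j, w j * δ j ^ 2 = ∑ i, w j * (u i - y (j i)) ^ 2 := fun j => by
          rw [hδ, Real.sq_sqrt (Finset.sum_nonneg fun i _ => sq_nonneg _), Finset.mul_sum]
        simp_rw [this]
        rw [Finset.sum_comm]
        simpa using Finset.sum_le_sum fun i (_ : i ∈ Finset.univ) => hw2 i
      refine abs_le_of_sq_le_sq' ?_ (by positivity) |>.2
      rw [mul_pow, Real.sq_sqrt (Nat.cast_nonneg k)]
      rw [hw1, one_mul] at hsq
      exact hsq.trans hvar
    have hdiff : eval u (∑ j : Fin k → Fin (n + 1), C (h fun i => y (j i)) *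
        ∏ i, Polynomial.aeval (X i : MvPolynomial (Fin k) ℝ) (κ (j i))) - h u =
        ∑ j, w j * ((h fun i => y (j i)) - h u) := by
      simp_rw [heval, mul_sub]
      rw [Finset.sum_sub_distrib, ← Finset.sum_mul, hw1, one_mul]
    rw [hdiff]
    calc |∑ j, w j * ((h fun i => y (j i)) - h u)|
        ≤ ∑ j, |w j * ((h fun i => y (j i)) - h u)| := Finset.abs_sum_le_sum_abs _ _
      _ ≤ ∑ j, L * (w j * δ j) := by
          refine Finset.sum_le_sum fun j _ => ?_
          rw [abs_mul, abs_of_nonneg (hw0 j), abs_sub_comm]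
          calc _ ≤ w j * (L * δ j) := mul_le_mul_of_nonneg_left (hlip _ _) (hw0 j)
            _ = _ := by ring
      _ = L * ∑ j, w j * δ j := by rw [Finset.mul_sum]
      _ ≤ _ := mul_le_mul_of_nonneg_left hmean hL

end Cube

/-! ### Sandwiching between Lipschitz envelopes -/

section Pair

open MvPolynomial

/-- If `hDown ≤ g ≤ hUp` with Lipschitz envelopes, then Jackson's theorem gives polynomials above
and below `g` on the cube. Adding `∑ (6 u_i) ^ (2 k n)`, which is small inside a
smaller cube, makes the inequalities hold on all of `ℝ^k`, since a polynomial of degree `k n` and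
coefficient sum `6 ^ (k n)` is dominated by it outside the cube. -/
theorem exists_polynomial_pair {n k : ℕ} (hn : 1 ≤ n) (hk : 1 ≤ k) {g hUp hDown : (Fin k → ℝ) → ℝ}
    {L η : ℝ} (hL : 0 ≤ L) (hη : L * (√k * (4 / n)) ≤ η) (hη1 : η ≤ 1)
    (hg : ∀ u, |g u| ≤ 1) (hbUp : ∀ u, |hUp u| ≤ 1) (hbDown : ∀ u, |hDown u| ≤ 1)
    (hlUp : ∀ u v, |hUp u - hUp v| ≤ L * √(∑ i, (u i - v i) ^ 2))
    (hlDown : ∀ u v, |hDown u - hDown v| ≤ L * √(∑ i, (u i - v i) ^ 2))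
    (hle : ∀ u, hDown u ≤ g u ∧ g u ≤ hUp u) :
    ∃ PUp PDown : MvPolynomial (Fin k) ℝ,
      SizeLE PUp (2 * (k * n)) (36 ^ (2 * (k * n))) ∧
      SizeLE PDown (2 * (k * n)) (36 ^ (2 * (k * n))) ∧
      ∀ u, eval u PDown ≤ g u ∧ g u ≤ eval u PUp ∧
        eval u PUp - eval u PDown ≤
          (hUp u - hDown u) + 4 * η + 3 * ∑ i, (6 * |u i|) ^ (2 * (k * n)) := by
  obtain ⟨QUp, hsUp, heUp⟩ := exists_cube_approx hn hL hbUp hlUp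
  obtain ⟨QDown, hsDown, heDown⟩ := exists_cube_approx hn hL hbDown hlDown
  have hη0 : 0 ≤ η := le_trans (by positivity) hη
  set N := k * n with hN
  have hN1 : 1 ≤ N := Nat.mul_pos hk hn
  have hkN : k ≤ N := Nat.le_mul_of_pos_right k hn
  set corr : MvPolynomial (Fin k) ℝ := ∑ i, (C 6 * X i) ^ (2 * N) with hcorr
  have hevalc : ∀ u, eval u corr = ∑ i, (6 * |u i|) ^ (2 * N) := fun u => by
    simp [hcorr, pow_mul, mul_pow]
  have hsc : SizeLE corr (2 * N) (k * 36 ^ N) := by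
    have h := SizeLE.sum (S := Finset.univ) fun i _ =>
      ((SizeLE.var (d := k) i).const_mul 6).pow (2 * N)
    refine h.mono (by simp) ?_
    simp only [Finset.sum_const, Finset.card_univ, Fintype.card_fin, nsmul_eq_mul, mul_one, pow_mul]
    norm_num
  have hsum : SizeLE (C η + corr) (2 * N) (|η| + k * 36 ^ N) :=
    ((SizeLE.const η).mono (Nat.zero_le _) le_rfl).add hsc
  have hsize : (6 : ℝ) ^ N + (|η| + k * 36 ^ N) ≤ 36 ^ (2 * N) := by
    have h1 : (6 : ℝ) ^ N ≤ 36 ^ N := pow_le_pow_left₀ (by norm_num) (by norm_num) N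
    have h2 : (1 : ℝ) ≤ 36 ^ N := one_le_pow₀ (by norm_num)
    have h3 : (2 : ℝ) + k ≤ 36 ^ N := by
      have h4 : 2 + N ≤ 36 ^ N := by
        have h5 := Nat.lt_two_pow_self (n := N)
        have h6 : 2 ≤ 2 ^ N := Nat.le_self_pow (by omega) 2
        calc 2 + N ≤ 2 * 2 ^ N := by omega
          _ ≤ 18 ^ N * 2 ^ N := Nat.mul_le_mul_right _
            (le_trans (by norm_num) (Nat.le_self_pow (by omega) 18))
          _ = 36 ^ N := by rw [← mul_pow]; norm_num
      exact_mod_cast (Nat.add_le_add_left hkN 2).trans h4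
    rw [abs_of_nonneg hη0, two_mul, pow_add]
    calc (6 : ℝ) ^ N + (η + k * 36 ^ N) ≤ 36 ^ N + (36 ^ N + k * 36 ^ N) := by
          gcongr; linarith
      _ = (2 + k) * 36 ^ N := by ring
      _ ≤ _ := by gcongr
  refine ⟨QUp + (C η + corr), QDown - (C η + corr),
    ((hsUp.mono (by omega) le_rfl).add hsum).mono le_rfl hsize,
    ((hsDown.mono (by omega) le_rfl).sub hsum).mono le_rfl hsize, fun u => ?_⟩
  simp only [map_add, map_sub, eval_C, hevalc]
  have hc0 : 0 ≤ ∑ i, (6 * |u i|) ^ (2 * N) :=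
    Finset.sum_nonneg fun i _ => by positivity
  obtain ⟨hd, hu⟩ := hle u
  by_cases hcube : ∀ i, |u i| ≤ 1
  · have h1 := abs_le.mp ((heUp u hcube).trans hη)
    have h2 := abs_le.mp ((heDown u hcube).trans hη)
    refine ⟨by linarith, by linarith, by linarith⟩
  · push Not at hcube
    obtain ⟨i₀, hi₀⟩ := hcube
    obtain ⟨i, -, hi⟩ := Finset.exists_max_image Finset.univ (fun i => |u i|) ⟨i₀, Finset.mem_univ _⟩
    have hM : 1 < |u i| := hi₀.trans_le (hi i₀ (Finset.mem_univ _))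
    have hall : ∀ j, |u j| ≤ |u i| := fun j => hi j (Finset.mem_univ _)
    have h1 := hsUp.abs_eval_le hM.le hall
    have h2 := hsDown.abs_eval_le hM.le hall
    rw [← mul_pow] at h1 h2
    set t := (6 * |u i|) ^ N with ht
    have h6 : 6 ≤ t := by
      calc (6 : ℝ) ≤ 6 * |u i| := by linarith
        _ ≤ t := le_self_pow₀ (by linarith) (by omega)
    have hct : t ^ 2 ≤ ∑ i, (6 * |u i|) ^ (2 * N) := by
      rw [ht, ← pow_mul, mul_comm N 2]
      exact Finset.single_le_sum (f := fun i => (6 * |u i|) ^ (2 * N))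
        (fun j _ => by positivity) (Finset.mem_univ i)
    have ht2 : 2 * t + 1 ≤ t ^ 2 := by nlinarith
    have h1 := abs_le.mp h1
    have h2 := abs_le.mp h2
    have h3 := abs_le.mp (hg u)
    refine ⟨by linarith, by linarith, by linarith⟩

end Pair

/-! ### Moments from tails -/

section Moments

variable {Ω : Type*} [MeasurableSpace Ω] {D : Measure Ω}

/-- A dyadic decomposition of the `q`-th moment: if the tails of `g` at the levels `2 ^ j / 2` beat
the growth of the `q`-th power, then the `q`-th moment is of order `2 ^ (-q)`. -/
theorem lintegral_rpow_le_of_dyadic_tails [IsProbabilityMeasure D] {g : Ω → ℝ} (hg : Measurable g)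
    (hg0 : ∀ x, 0 ≤ g x) {α q : ℝ} (hα : 0 ≤ α) (hq : 1 ≤ q)
    (htail : ∀ j : ℕ, D {x | 2 ^ j / 2 ≤ g x} ≤
      ENNReal.ofReal (α * Real.exp (-(2 * q * 2 ^ j)))) :
    ∫⁻ x, ENNReal.ofReal (g x ^ q) ∂D ≤ ENNReal.ofReal (2 ^ (-q) * (1 + α)) := by
  have hmeas : ∀ j : ℕ, MeasurableSet {x | 2 ^ j / 2 ≤ g x} := fun j =>
    measurableSet_le measurable_const hg
  have hpt : ∀ x, ENNReal.ofReal (g x ^ q) ≤ ENNReal.ofReal (2 ^ (-q)) +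
      ∑' j : ℕ, Set.indicator {x | 2 ^ j / 2 ≤ g x}
        (fun _ => ENNReal.ofReal ((2 ^ j) ^ q)) x := by
    intro x
    rcases lt_or_ge (g x) (1 / 2) with hx | hx
    · refine le_add_right (ENNReal.ofReal_le_ofReal ?_)
      rw [Real.rpow_neg (by norm_num), ← Real.inv_rpow (by norm_num)]
      exact Real.rpow_le_rpow (hg0 x) (by linarith) (by linarith)
    · have hex : ∃ j : ℕ, g x < 2 ^ j := pow_unbounded_of_one_lt _ (by norm_num)
      classical
      have hlt := Nat.find_spec hex
      have hmem : x ∈ {x | 2 ^ (Nat.find hex) / 2 ≤ g x} := by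
        rcases Nat.eq_zero_or_pos (Nat.find hex) with h0 | h0
        · simpa [h0] using hx
        · have hm := Nat.find_min hex (Nat.sub_lt h0 one_pos)
          have he : (2 : ℝ) ^ (Nat.find hex) = 2 ^ (Nat.find hex - 1) * 2 := by
            rw [← pow_succ, Nat.sub_add_cancel h0]
          simp only [Set.mem_ofPred_eq, he]
          linarith
      refine le_add_left (le_trans ?_ (ENNReal.le_tsum (Nat.find hex)))
      rw [Set.indicator_of_mem hmem]
      exact ENNReal.ofReal_le_ofReal (Real.rpow_le_rpow (hg0 x) hlt.le (by linarith))
  have hterm : ∀ j : ℕ, ENNReal.ofReal ((2 ^ j) ^ q) * D {x | 2 ^ j / 2 ≤ g x} ≤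
      ENNReal.ofReal (2 ^ (-q) * α) * (2⁻¹ : ℝ≥0∞) ^ (j + 1) := by
    intro j
    have h2 : (2⁻¹ : ℝ≥0∞) ^ (j + 1) = ENNReal.ofReal ((2⁻¹ : ℝ) ^ (j + 1)) := by
      rw [ENNReal.ofReal_pow (by norm_num), ENNReal.ofReal_inv_of_pos (by norm_num)]
      norm_num
    rw [h2, ← ENNReal.ofReal_mul (by positivity)]
    refine (mul_le_mul_right (htail j) _).trans ?_
    rw [← ENNReal.ofReal_mul (by positivity)]
    refine ENNReal.ofReal_le_ofReal ?_
    have hexp : Real.exp (-(2 * q * 2 ^ j)) ≤ 2 ^ (-(2 * q * (j + 1))) := by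
      rw [Real.rpow_def_of_pos (by norm_num), Real.exp_le_exp]
      have hj : ((j : ℝ) + 1) ≤ 2 ^ j := by exact_mod_cast Nat.lt_two_pow_self (n := j)
      have hl : Real.log 2 ≤ 1 := by linarith [Real.log_two_lt_d9]
      have hl0 : 0 ≤ Real.log 2 := Real.log_nonneg (by norm_num)
      have hq2 : 0 ≤ 2 * q * (j + 1) := by positivity
      have := mul_le_mul_of_nonneg_right hl hq2
      have := mul_le_mul_of_nonneg_left hj (by positivity : 0 ≤ 2 * q)
      linarith
    have hpow : ((2 : ℝ) ^ j) ^ q * 2 ^ (-(2 * q * (j + 1))) ≤ 2 ^ (-q) * 2⁻¹ ^ (j + 1) := by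
      rw [← Real.rpow_natCast 2 j, ← Real.rpow_mul (by norm_num), ← Real.rpow_add (by norm_num),
        ← Real.rpow_natCast 2⁻¹, Real.inv_rpow (by norm_num), ← Real.rpow_neg (by norm_num),
        ← Real.rpow_add (by norm_num)]
      refine Real.rpow_le_rpow_of_exponent_le (by norm_num) ?_
      push_cast
      nlinarith [mul_le_mul_of_nonneg_right hq (by positivity : (0 : ℝ) ≤ j + 1)]
    calc ((2 : ℝ) ^ j) ^ q * (α * Real.exp (-(2 * q * 2 ^ j)))
        ≤ (2 ^ j) ^ q * (α * 2 ^ (-(2 * q * (j + 1)))) := by gcongr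
      _ = α * (((2 : ℝ) ^ j) ^ q * 2 ^ (-(2 * q * (j + 1)))) := by ring
      _ ≤ α * (2 ^ (-q) * 2⁻¹ ^ (j + 1)) := by gcongr
      _ = _ := by ring
  calc ∫⁻ x, ENNReal.ofReal (g x ^ q) ∂D
      ≤ ∫⁻ x, (ENNReal.ofReal (2 ^ (-q)) + ∑' j : ℕ, Set.indicator {x | 2 ^ j / 2 ≤ g x}
          (fun _ => ENNReal.ofReal ((2 ^ j) ^ q)) x) ∂D := lintegral_mono hpt
    _ = ENNReal.ofReal (2 ^ (-q)) +
          ∑' j : ℕ, ENNReal.ofReal ((2 ^ j) ^ q) * D {x | 2 ^ j / 2 ≤ g x} := by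
        rw [lintegral_add_left measurable_const, lintegral_const, measure_univ, mul_one,
          lintegral_tsum fun j => (measurable_const.indicator (hmeas j)).aemeasurable]
        simp_rw [lintegral_indicator_const (hmeas _)]
    _ ≤ ENNReal.ofReal (2 ^ (-q)) +
          ∑' j : ℕ, ENNReal.ofReal (2 ^ (-q) * α) * (2⁻¹ : ℝ≥0∞) ^ (j + 1) := by
        exact add_le_add_right (ENNReal.tsum_le_tsum hterm) _
    _ = ENNReal.ofReal (2 ^ (-q) * (1 + α)) := by
        rw [ENNReal.tsum_mul_left, ENNReal.tsum_geometric_add_one, ENNReal.one_sub_inv_two, inv_inv,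
          ENNReal.inv_mul_cancel (by norm_num) (by norm_num), mul_one,
          ← ENNReal.ofReal_add (by positivity) (by positivity)]
        congr 1; ring

theorem eLpNorm_pow_le [IsProbabilityMeasure D] {g : Ω → ℝ} (hg : Measurable g)
    (hg0 : ∀ x, 0 ≤ g x) {α s : ℝ} (hα : 0 ≤ α) (hs : 1 ≤ s) {m : ℕ} (hm : 1 ≤ m)
    (htail : ∀ j : ℕ, D {x | 2 ^ j / 2 ≤ g x} ≤
      ENNReal.ofReal (α * Real.exp (-(2 * (m * s) * 2 ^ j)))) :
    eLpNorm (fun x => g x ^ m) (ENNReal.ofReal s) D ≤ ENNReal.ofReal (2⁻¹ ^ m * (1 + α)) := by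
  have hs0 : 0 < s := by linarith
  have hm1 : (1 : ℝ) ≤ m := by exact_mod_cast hm
  have h := lintegral_rpow_le_of_dyadic_tails hg hg0 hα (q := m * s) (by nlinarith) htail
  rw [eLpNorm_eq_lintegral_rpow_enorm_toReal (by simpa using hs0) ENNReal.ofReal_ne_top,
    ENNReal.toReal_ofReal hs0.le]
  have heq : ∀ x, ‖g x ^ m‖ₑ ^ s = ENNReal.ofReal (g x ^ (m * s)) := fun x => by
    rw [Real.enorm_eq_ofReal (pow_nonneg (hg0 x) m),
      ENNReal.ofReal_rpow_of_nonneg (pow_nonneg (hg0 x) m) hs0.le, Real.rpow_mul (hg0 x),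
      Real.rpow_natCast]
  simp_rw [heq]
  calc _ ≤ (ENNReal.ofReal (2 ^ (-(m * s)) * (1 + α))) ^ (1 / s) := by gcongr
    _ = ENNReal.ofReal ((2 ^ (-(m * s)) * (1 + α)) ^ (1 / s)) :=
        ENNReal.ofReal_rpow_of_nonneg (by positivity) (by positivity)
    _ ≤ _ := by
        refine ENNReal.ofReal_le_ofReal ?_
        rw [Real.mul_rpow (by positivity) (by positivity), ← Real.rpow_mul (by norm_num)]
        have he : -(m * s) * (1 / s) = -(m : ℝ) := by field_simp
        rw [he, Real.rpow_neg (by norm_num), Real.rpow_natCast, inv_pow]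
        refine mul_le_mul_of_nonneg_left ?_ (by positivity)
        calc (1 + α) ^ (1 / s) ≤ (1 + α) ^ (1 : ℝ) :=
              Real.rpow_le_rpow_of_exponent_le (by linarith)
                ((div_le_one hs0).mpr hs)
          _ = 1 + α := Real.rpow_one _

/-- The three contributions to the `L^s` norm of the gap between the sandwiching polynomials: a
boundary set of small measure, a constant and the high powers of the coordinates. -/
theorem eLpNorm_gap_le [IsProbabilityMeasure D] {k m : ℕ} {F : Ω → ℝ} {g : Fin k → Ω → ℝ}
    {U : Set Ω} {α ε s : ℝ} (hε : 0 < ε) (hα : 0 ≤ α) (hs : 1 ≤ s) (hm : 1 ≤ m)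
    (hU : MeasurableSet U) (hDU : D U ≤ ENNReal.ofReal ((ε / 2) ^ s / 2))
    (hg : ∀ i, Measurable (g i)) (hg0 : ∀ i x, 0 ≤ g i x)
    (htail : ∀ i, ∀ j : ℕ, D {x | 2 ^ j / 2 ≤ g i x} ≤
      ENNReal.ofReal (α * Real.exp (-(2 * (m * s) * 2 ^ j))))
    (hsmall : 3 * (k * (2⁻¹ ^ m * (1 + α))) ≤ ε / (4 * s))
    (hF0 : ∀ x, 0 ≤ F x)
    (hF : ∀ x, F x ≤ U.indicator (fun _ => 2) x + ε / (4 * s) + 3 * ∑ i, g i x ^ m) :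
    eLpNorm F (ENNReal.ofReal s) D ≤ ENNReal.ofReal ε := by
  have hs0 : 0 < s := by linarith
  have hp : 1 ≤ ENNReal.ofReal s := by simpa using ENNReal.ofReal_le_ofReal hs
  have hp0 : ENNReal.ofReal s ≠ 0 := by simpa using hs0
  have hmeasU : Measurable (U.indicator fun _ : Ω => (2 : ℝ)) := measurable_const.indicator hU
  have hpow : ∀ i, Measurable fun x => g i x ^ m := fun i => (hg i).pow_const m
  have hsum : Measurable fun x => ∑ i, g i x ^ m :=
    Finset.measurable_sum _ fun i _ => hpow i
  have h1 : eLpNorm (U.indicator fun _ : Ω => (2 : ℝ)) (ENNReal.ofReal s) D ≤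
      ENNReal.ofReal (ε * (1 - 1 / (2 * s))) := by
    rw [eLpNorm_indicator_const hU hp0 ENNReal.ofReal_ne_top, ENNReal.toReal_ofReal hs0.le]
    calc ‖(2 : ℝ)‖ₑ * D U ^ (1 / s)
        ≤ ‖(2 : ℝ)‖ₑ * (ENNReal.ofReal ((ε / 2) ^ s / 2)) ^ (1 / s) := by gcongr
      _ = ENNReal.ofReal (2 * ((ε / 2) ^ s / 2) ^ (1 / s)) := by
          rw [ENNReal.ofReal_rpow_of_nonneg (by positivity) (by positivity),
            Real.enorm_eq_ofReal (by norm_num), ENNReal.ofReal_mul (by norm_num)]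
      _ ≤ _ := by
          refine ENNReal.ofReal_le_ofReal ?_
          -- Bernoulli: `1 / 2 ≤ (1 - 1 / (2 s)) ^ s`
          have hinv : 1 / (2 * s) ≤ 1 / 2 :=
            one_div_le_one_div_of_le (by norm_num) (by linarith)
          have hb0 : 0 ≤ 1 - 1 / (2 * s) := by linarith
          have hb : 1 / 2 ≤ (1 - 1 / (2 * s)) ^ s := by
            have := one_add_mul_self_le_rpow_one_add (s := -(1 / (2 * s))) (by linarith) hs
            have he : 1 + s * -(1 / (2 * s)) = 1 / 2 := by field_simp; norm_num
            rw [he] at this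
            simpa [sub_eq_add_neg] using this
          have hle : (ε / 2) ^ s / 2 ≤ (ε / 2 * (1 - 1 / (2 * s))) ^ s := by
            rw [Real.mul_rpow (by positivity) hb0, div_eq_mul_one_div]
            gcongr
          calc 2 * ((ε / 2) ^ s / 2) ^ (1 / s)
              ≤ 2 * ((ε / 2 * (1 - 1 / (2 * s))) ^ s) ^ (1 / s) := by gcongr
            _ = ε * (1 - 1 / (2 * s)) := by
              rw [← Real.rpow_mul (by positivity), mul_one_div_cancel hs0.ne', Real.rpow_one]
              ring
  have h2 : eLpNorm (fun _ : Ω => ε / (4 * s)) (ENNReal.ofReal s) D ≤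
      ENNReal.ofReal (ε / (4 * s)) := by
    rw [eLpNorm_const _ hp0 (IsProbabilityMeasure.ne_zero D), measure_univ, ENNReal.one_rpow,
      mul_one, Real.enorm_eq_ofReal (by positivity)]
  have h3 : eLpNorm (fun x => 3 * ∑ i, g i x ^ m) (ENNReal.ofReal s) D ≤
      ENNReal.ofReal (ε / (4 * s)) := by
    have hadd : eLpNorm (fun x => ∑ i, g i x ^ m) (ENNReal.ofReal s) D ≤
        ∑ i : Fin k, ENNReal.ofReal (2⁻¹ ^ m * (1 + α)) := by
      have := eLpNorm_sum_le (μ := D) (p := ENNReal.ofReal s) (s := (Finset.univ : Finset (Fin k)))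
        (f := fun i x => g i x ^ m) (fun i _ => (hpow i).aestronglyMeasurable) hp
      refine le_trans ?_ (this.trans (Finset.sum_le_sum fun i _ =>
        eLpNorm_pow_le (hg i) (hg0 i) hα hs hm (htail i)))
      exact le_of_eq (by congr 1; ext x; simp)
    have hsmul := eLpNorm_const_smul_le (c := (3 : ℝ)) (f := fun x => ∑ i, g i x ^ m)
      (p := ENNReal.ofReal s) (μ := D)
    refine hsmul.trans ?_
    rw [Real.enorm_eq_ofReal (by norm_num)]
    calc _ ≤ ENNReal.ofReal 3 * ∑ i : Fin k, ENNReal.ofReal (2⁻¹ ^ m * (1 + α)) := by gcongr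
      _ = ENNReal.ofReal (3 * (k * (2⁻¹ ^ m * (1 + α)))) := by
        rw [ENNReal.ofReal_mul (p := 3) (by norm_num),
          ENNReal.ofReal_mul (p := (k : ℝ)) (Nat.cast_nonneg k)]
        simp
      _ ≤ _ := ENNReal.ofReal_le_ofReal hsmall
  have hmono : eLpNorm F (ENNReal.ofReal s) D ≤
      eLpNorm ((U.indicator fun _ : Ω => (2 : ℝ)) + (fun _ : Ω => ε / (4 * s)) +
        fun x => 3 * ∑ i, g i x ^ m) (ENNReal.ofReal s) D :=
    eLpNorm_mono_real fun x => by
      rw [Real.norm_of_nonneg (hF0 x)]; exact hF x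
  refine hmono.trans ((eLpNorm_add_le (hmeasU.add measurable_const).aestronglyMeasurable
    (hsum.const_mul 3).aestronglyMeasurable hp).trans ?_)
  refine (add_le_add_left (eLpNorm_add_le hmeasU.aestronglyMeasurable
    measurable_const.aestronglyMeasurable hp) _).trans ?_
  refine (add_le_add (add_le_add h1 h2) h3).trans ?_
  have hinv : 1 / (2 * s) ≤ 1 / 2 := one_div_le_one_div_of_le (by norm_num) (by linarith)
  have hb0 : 0 ≤ ε * (1 - 1 / (2 * s)) := mul_nonneg hε.le (by linarith)
  rw [← ENNReal.ofReal_add hb0 (by positivity),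
    ← ENNReal.ofReal_add (by positivity) (by positivity)]
  refine ENNReal.ofReal_le_ofReal (le_of_eq ?_)
  field_simp
  ring

end Moments

/-! ### Concepts of low intrinsic dimension -/

section Projection

variable {d k : ℕ}

/-- The linear map `x ↦ W x` between Euclidean spaces. -/
noncomputable def proj (W : Matrix (Fin k) (Fin d) ℝ) (x : E d) : E k :=
  WithLp.toLp 2 (W.mulVec x.ofLp)

theorem proj_apply (W : Matrix (Fin k) (Fin d) ℝ) (x : E d) (i : Fin k) :
    proj W x i = ∑ j, W i j * x j := rfl

theorem proj_apply_eq_inner (W : Matrix (Fin k) (Fin d) ℝ) (x : E d) (i : Fin k) :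
    proj W x i = inner ℝ (WithLp.toLp 2 (W i) : E d) x := by
  rw [proj_apply, PiLp.inner_apply]
  exact Finset.sum_congr rfl fun j _ => by simp [mul_comm]

theorem continuous_proj (W : Matrix (Fin k) (Fin d) ℝ) : Continuous (proj W) := by
  refine (PiLp.continuous_toLp 2 _).comp (continuous_pi fun i => ?_)
  change Continuous fun x : E d => ∑ j, W i j * x j
  fun_prop

theorem sum_sq_row {W : Matrix (Fin k) (Fin d) ℝ} (hW : W * W.transpose = 1) (i : Fin k) :
    ∑ j, W i j ^ 2 = 1 := by
  have := congrFun (congrFun hW i) i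
  simpa [Matrix.mul_apply, sq] using this

theorem norm_row {W : Matrix (Fin k) (Fin d) ℝ} (hW : W * W.transpose = 1) (i : Fin k) :
    ‖(WithLp.toLp 2 (W i) : E d)‖ = 1 := by
  rw [EuclideanSpace.norm_eq]
  simp [sum_sq_row hW i]

theorem abs_entry_le_one {W : Matrix (Fin k) (Fin d) ℝ} (hW : W * W.transpose = 1) (i : Fin k)
    (j : Fin d) : |W i j| ≤ 1 := by
  rw [← sq_le_one_iff_abs_le_one, ← sum_sq_row hW i]
  exact Finset.single_le_sum (f := fun j => W i j ^ 2) (fun _ _ => sq_nonneg _)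
    (Finset.mem_univ j)

/-- The map `x ↦ W x` is a metric submersion: a displacement of `W x` lifts to a displacement of
`x` of the same length, by applying `Wᵀ`. -/
theorem exists_lift {W : Matrix (Fin k) (Fin d) ℝ} (hW : W * W.transpose = 1) (x : E d) (z : E k) :
    ∃ v : E d, ‖v‖ = dist (proj W x) z ∧ proj W (x + v) = z := by
  refine ⟨WithLp.toLp 2 (W.transpose.mulVec (z - proj W x).ofLp), ?_, ?_⟩
  · rw [dist_comm, dist_eq_norm, ← sq_eq_sq₀ (norm_nonneg _) (norm_nonneg _),
      EuclideanSpace.real_norm_sq_eq, EuclideanSpace.real_norm_sq_eq]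
    have h : ∀ {m : ℕ} (w : Fin m → ℝ), ∑ i, w i ^ 2 = w ⬝ᵥ w := fun w => by
      simp [dotProduct, sq]
    rw [h, h (z - proj W x).ofLp, Matrix.dotProduct_mulVec, Matrix.vecMul_transpose,
      Matrix.mulVec_mulVec, hW, Matrix.one_mulVec]
  · have : W.mulVec (x.ofLp + W.transpose.mulVec (z - proj W x).ofLp) = z.ofLp := by
      rw [Matrix.mulVec_add, Matrix.mulVec_mulVec, hW, Matrix.one_mulVec]
      simp [proj]
    exact congrArg (WithLp.toLp 2) this

/-- The points whose image under `W` is within distance less than `ρ` of both sides of the concept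
have measure at most `σ ρ`. -/
theorem measure_boundary_le {f : E d → ℝ} {G : E k → ℝ} {W : Matrix (Fin k) (Fin d) ℝ}
    {D : Measure (E d)} {σ ρ : ℝ} (hG : IsConcept G) (hW : W * W.transpose = 1)
    (hf : ∀ x, f x = G (proj W x)) (hsmooth : HasSmoothBoundary f D σ) (hρ : 0 < ρ) :
    D (proj W ⁻¹' (Metric.thickening ρ {z | G z = 1} ∩ Metric.thickening ρ {z | G z = 1}ᶜ)) ≤
      ENNReal.ofReal (σ * ρ) := by
  set U := proj W ⁻¹' (Metric.thickening ρ {z | G z = 1} ∩ Metric.thickening ρ {z | G z = 1}ᶜ)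
    with hU
  have hmeas : MeasurableSet U :=
    ((Metric.isOpen_thickening.inter Metric.isOpen_thickening).preimage
      (continuous_proj W)).measurableSet
  rw [← lintegral_indicator_one hmeas]
  refine (lintegral_mono fun x => ?_).trans (hsmooth ρ hρ.le)
  refine Set.indicator_le (s := U) (f := 1)
    (g := fun x => ENNReal.ofReal ((dilation f ρ x - erosion f ρ x) / 2)) (fun x hx => ?_) x
  obtain ⟨h1, h2⟩ := hx
  obtain ⟨z, hz, hxz⟩ := Metric.mem_thickening_iff.mp h1
  obtain ⟨z', hz', hxz'⟩ := Metric.mem_thickening_iff.mp h2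
  obtain ⟨v, hv, hvz⟩ := exists_lift hW x z
  obtain ⟨v', hv', hvz'⟩ := exists_lift hW x z'
  have hbd : ∀ y, -1 ≤ f y ∧ f y ≤ 1 := fun y => by
    rw [hf]; rcases hG (proj W y) with h | h <;> rw [h] <;> norm_num
  have hup : 1 ≤ dilation f ρ x := by
    have := le_ciSup (f := fun z : Metric.closedBall (0 : E d) ρ => f (x + z))
      ⟨1, by rintro _ ⟨z, rfl⟩; exact (hbd _).2⟩ ⟨v, by simp [hv, hxz.le]⟩
    rwa [show f (x + v) = 1 by rw [hf, hvz]; exact hz] at this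
  have hdown : erosion f ρ x ≤ -1 := by
    have := ciInf_le (f := fun z : Metric.closedBall (0 : E d) ρ => f (x + z))
      ⟨-1, by rintro _ ⟨z, rfl⟩; exact (hbd _).1⟩ ⟨v', by simp [hv', hxz'.le]⟩
    rwa [show f (x + v') = -1 by rw [hf, hvz']; exact (hG z').resolve_right hz'] at this
  rw [Pi.one_apply, ← ENNReal.ofReal_one]
  exact ENNReal.ofReal_le_ofReal (by linarith)

theorem measure_coordinate_tail_le {W : Matrix (Fin k) (Fin d) ℝ} {D : Measure (E d)}
    {α β γ R T : ℝ} (hW : W * W.transpose = 1) (htails : IsStrictlySubexponential D γ α β)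
    (hα : 0 < α) (hβ : 0 < β) (hγ : 0 < γ) (hR : 0 < R) (hT : T ≤ β * (R / 12) ^ (1 + γ))
    (i : Fin k) (j : ℕ) :
    D {x | 2 ^ j / 2 ≤ 6 * |proj W x i / R|} ≤ ENNReal.ofReal (α * Real.exp (-(T * 2 ^ j))) := by
  have hset : {x | 2 ^ j / 2 ≤ 6 * |proj W x i / R|} =
      {x | 2 ^ j * (R / 12) ≤ |inner ℝ (WithLp.toLp 2 (W i) : E d) x|} := by
    ext x
    simp only [Set.mem_ofPred_eq]
    rw [proj_apply_eq_inner, abs_div, abs_of_pos hR, ← mul_div_assoc, le_div_iff₀ hR]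
    constructor <;> intro h <;> linarith
  rw [hset]
  refine (htails _ (norm_row hW i) _ (by positivity)).trans (ENNReal.ofReal_le_ofReal ?_)
  gcongr
  rw [Real.mul_rpow (by positivity) (by positivity), neg_mul, neg_le_neg_iff]
  have h2 : (2 : ℝ) ^ j ≤ (2 ^ j) ^ (1 + γ) :=
    Real.self_le_rpow_of_one_le (one_le_pow₀ (by norm_num)) (by linarith)
  have h3 : 0 ≤ β * (R / 12) ^ (1 + γ) := by positivity
  calc T * 2 ^ j ≤ β * (R / 12) ^ (1 + γ) * 2 ^ j := by gcongr
    _ ≤ β * (R / 12) ^ (1 + γ) * (2 ^ j) ^ (1 + γ) := by gcongr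
    _ = _ := by ring

end Projection

section Sandwiching

variable {d k : ℕ}

theorem abs_thickenedIndicator_sub_le {ρ R : ℝ} (hρ : 0 < ρ) (hR : 0 < R) (A : Set (E k))
    (u v : Fin k → ℝ) :
    |2 * (thickenedIndicator hρ A (WithLp.toLp 2 (R • u)) : ℝ) -
        2 * (thickenedIndicator hρ A (WithLp.toLp 2 (R • v)) : ℝ)| ≤
      2 / ρ * R * √(∑ i, (u i - v i) ^ 2) := by
  have h := (lipschitzWith_thickenedIndicator hρ A).dist_le_mul
    (WithLp.toLp 2 (R • u)) (WithLp.toLp 2 (R • v))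
  rw [NNReal.dist_eq, EuclideanSpace.dist_eq] at h
  have hd : √(∑ i, dist ((WithLp.toLp 2 (R • u) : E k) i) ((WithLp.toLp 2 (R • v) : E k) i) ^ 2) =
      R * √(∑ i, (u i - v i) ^ 2) := by
    have : ∀ i, dist ((WithLp.toLp 2 (R • u) : E k) i) ((WithLp.toLp 2 (R • v) : E k) i) ^ 2 =
        R ^ 2 * (u i - v i) ^ 2 := fun i => by
      simp [Real.dist_eq, ← mul_sub, mul_pow]
    simp_rw [this]
    rw [← Finset.mul_sum, Real.sqrt_mul (sq_nonneg R), Real.sqrt_sq hR.le]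
  rw [hd, NNReal.coe_inv, Real.coe_toNNReal _ hρ.le] at h
  rw [← mul_sub, abs_mul, abs_two]
  calc _ ≤ 2 * (ρ⁻¹ * (R * √(∑ i, (u i - v i) ^ 2))) := by gcongr
    _ = _ := by ring

/-- Sandwiching polynomials for a concept `G (W x)`, given a scale `R` of the cube and a degree `n`
per coordinate that satisfy the three requirements of the argument: the tails beat the growth of
the polynomials outside the cube, the degree is large enough for the Jackson error, and the high
power that is added has a small contribution. -/
theorem exists_isSandwiching {f : E d → ℝ} {G : E k → ℝ} {W : Matrix (Fin k) (Fin d) ℝ}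
    {D : Measure (E d)} [IsProbabilityMeasure D] {σ α β γ ε s R : ℝ} {n : ℕ}
    (hG : IsConcept G) (hW : W * W.transpose = 1)
    (hf : ∀ x, f x = G (proj W x)) (hsmooth : HasSmoothBoundary f D σ)
    (htails : IsStrictlySubexponential D γ α β) (hα : 0 < α) (hβ : 0 < β) (hγ : 0 < γ)
    (hσ : 1 ≤ σ) (hε : 0 < ε) (hε1 : ε < 1) (hs : 1 ≤ s) (hk : 1 ≤ k) (hd : 1 ≤ d) (hn : 1 ≤ n)
    (hR : 1 ≤ R) (hgrowth : 2 * ((2 * (k * n) : ℕ) * s) ≤ β * (R / 12) ^ (1 + γ))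
    (hjackson : 4 * σ / (ε / 2) ^ s * R * (√k * (4 / n)) ≤ ε / (16 * s))
    (hsmall : 3 * (k * (2⁻¹ ^ (2 * (k * n)) * (1 + α))) ≤ ε / (4 * s)) :
    ∃ pUp pDown : MvPolynomial (Fin d) ℝ,
      IsSandwiching f D ε s (2 * (k * n)) pUp pDown ∧
      coefSum pUp ≤ (36 * d) ^ (2 * (k * n)) ∧ coefSum pDown ≤ (36 * d) ^ (2 * (k * n)) := by
  have hR0 : 0 < R := by linarith
  have hs0 : 0 < s := by linarith
  have hσ0 : 0 < σ := by linarith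
  have hεs : 0 < (ε / 2) ^ s := Real.rpow_pos_of_pos (by positivity) s
  set ρ := (ε / 2) ^ s / (2 * σ) with hρdef
  have hρ : 0 < ρ := by positivity
  set A : Set (E k) := {z | G z = 1} with hA
  set tUp : E k → ℝ := fun z => 2 * (thickenedIndicator hρ A z : ℝ) - 1 with htUp
  set tDown : E k → ℝ := fun z => 1 - 2 * (thickenedIndicator hρ Aᶜ z : ℝ) with htDown
  have hind : ∀ (B : Set (E k)) z, 0 ≤ (thickenedIndicator hρ B z : ℝ) ∧
      (thickenedIndicator hρ B z : ℝ) ≤ 1 := fun B z =>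
    ⟨NNReal.coe_nonneg _, by exact_mod_cast thickenedIndicator_le_one hρ B z⟩
  have hbUp : ∀ z, |tUp z| ≤ 1 := fun z => by
    rw [abs_le]; constructor <;> simp only [htUp] <;> linarith [hind A z]
  have hbDown : ∀ z, |tDown z| ≤ 1 := fun z => by
    rw [abs_le]; constructor <;> simp only [htDown] <;> linarith [hind Aᶜ z]
  have hbG : ∀ z, |G z| ≤ 1 := fun z => by rcases hG z with h | h <;> rw [h] <;> norm_num
  have hle : ∀ z, tDown z ≤ G z ∧ G z ≤ tUp z := by
    intro z
    by_cases hz : z ∈ A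
    · have h1 : (thickenedIndicator hρ A z : ℝ) = 1 := by
        exact_mod_cast thickenedIndicator_one hρ A hz
      have h2 : G z = 1 := hz
      exact ⟨h2 ▸ (le_abs_self _).trans (hbDown z), by simp only [htUp, h1, h2]; norm_num⟩
    · have h1 : (thickenedIndicator hρ Aᶜ z : ℝ) = 1 := by
        exact_mod_cast thickenedIndicator_one hρ Aᶜ hz
      have h2 : G z = -1 := (hG z).resolve_right hz
      exact ⟨by simp only [htDown, h1, h2]; norm_num, h2 ▸ neg_le_of_abs_le (hbUp z)⟩
  -- away from the boundary the two envelopes agree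
  have hgap : ∀ z, tUp z - tDown z ≤
      (Metric.thickening ρ A ∩ Metric.thickening ρ Aᶜ).indicator (fun _ => 2) z := by
    intro z
    by_cases h1 : z ∈ Metric.thickening ρ A
    · by_cases h2 : z ∈ Metric.thickening ρ Aᶜ
      · rw [Set.indicator_of_mem (Set.mem_inter h1 h2)]
        linarith [abs_le.mp (hbUp z), abs_le.mp (hbDown z)]
      · rw [Set.indicator_of_notMem fun h => h2 h.2]
        have h3 : (thickenedIndicator hρ Aᶜ z : ℝ) = 0 := by
          exact_mod_cast thickenedIndicator_zero hρ Aᶜ h2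
        simp only [htUp, htDown, h3]
        linarith [hind A z]
    · rw [Set.indicator_of_notMem fun h => h1 h.1]
      have h3 : (thickenedIndicator hρ A z : ℝ) = 0 := by
        exact_mod_cast thickenedIndicator_zero hρ A h1
      simp only [htUp, htDown, h3]
      linarith [hind Aᶜ z]
  have hη1 : ε / (16 * s) ≤ 1 := by
    rw [div_le_one (by positivity)]; linarith
  have hL : 2 / ρ * R * (√k * (4 / n)) ≤ ε / (16 * s) := by
    have : 2 / ρ = 4 * σ / (ε / 2) ^ s := by rw [hρdef]; field_simp; norm_num
    rwa [this]
  obtain ⟨PUp, PDown, hsUp, hsDown, hP⟩ := exists_polynomial_pair hn hk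
    (g := fun u => G (WithLp.toLp 2 (R • u))) (hUp := fun u => tUp (WithLp.toLp 2 (R • u)))
    (hDown := fun u => tDown (WithLp.toLp 2 (R • u))) (by positivity) hL hη1
    (fun u => hbG _) (fun u => hbUp _) (fun u => hbDown _)
    (fun u v => by
      have := abs_thickenedIndicator_sub_le hρ hR0 A u v
      rwa [← sub_sub_sub_cancel_right _ _ 1] at this)
    (fun u v => by
      have := abs_thickenedIndicator_sub_le hρ hR0 Aᶜ v u
      simp_rw [fun i => sub_sq_comm (v i) (u i)] at this
      rwa [← sub_sub_sub_cancel_left _ _ 1] at this)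
    (fun u => hle _)
  set lin : Fin k → MvPolynomial (Fin d) ℝ := fun i =>
    ∑ j, MvPolynomial.C (W i j / R) * MvPolynomial.X j with hlin
  have hd1 : (1 : ℝ) ≤ d := by exact_mod_cast hd
  have hslin : ∀ i, SizeLE (lin i) 1 d := by
    intro i
    refine (SizeLE.sum (A := fun _ => 1) fun j _ =>
      ((SizeLE.var j).const_mul (W i j / R)).mono le_rfl ?_).mono le_rfl (by simp)
    rw [mul_one, abs_div, abs_of_pos hR0, div_le_one hR0]
    exact (abs_entry_le_one hW i j).trans hR
  have heval : ∀ (P : MvPolynomial (Fin k) ℝ) (x : E d),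
      evalAt (MvPolynomial.bind₁ lin P) x =
        MvPolynomial.eval (fun i => proj W x i / R) P := by
    intro P x
    have h1 : ∀ i, MvPolynomial.eval x.ofLp (lin i) = proj W x i / R := fun i => by
      simp [hlin, proj_apply, Finset.sum_div, div_mul_eq_mul_div]
    have h2 := MvPolynomial.aeval_bind₁ x.ofLp lin P
    simp only [MvPolynomial.aeval_eq_eval] at h2
    rw [evalAt]
    simpa [MvPolynomial.aeval_eq_eval, h1] using h2
  have hscale : ∀ x : E d, (WithLp.toLp 2 (R • fun i => proj W x i / R) : E k) = proj W x := by
    intro x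
    ext i
    simp [mul_div_cancel₀ _ hR0.ne']
  have hPx := fun x : E d => hP fun i => proj W x i / R
  simp only [hscale, ← heval, ← hf] at hPx
  have hcUp := hsUp.bind₁ hd1 hslin
  have hcDown := hsDown.bind₁ hd1 hslin
  rw [← mul_pow] at hcUp hcDown
  refine ⟨MvPolynomial.bind₁ lin PUp, MvPolynomial.bind₁ lin PDown,
    ⟨hcUp.1, hcDown.1, fun x => (hPx x).1, fun x => (hPx x).2.1, ?_⟩, hcUp.2, hcDown.2⟩
  refine eLpNorm_gap_le (m := 2 * (k * n)) (g := fun i x => 6 * |proj W x i / R|)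
    (U := proj W ⁻¹' (Metric.thickening ρ A ∩ Metric.thickening ρ Aᶜ)) hε hα.le hs
    (by have := Nat.mul_pos hk hn; omega) ?_ ?_ ?_ (fun i x => by positivity)
    (fun i j => measure_coordinate_tail_le hW htails hα hβ hγ hR0 hgrowth i j) hsmall
    (fun x => ?_) (fun x => ?_)
  · exact ((Metric.isOpen_thickening.inter Metric.isOpen_thickening).preimage
      (continuous_proj W)).measurableSet
  · refine (measure_boundary_le hG hW hf hsmooth hρ).trans (ENNReal.ofReal_le_ofReal ?_)
    rw [hρdef]
    exact le_of_eq (by field_simp)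
  · intro i
    have hi : Continuous fun x => proj W x i :=
      (EuclideanSpace.proj (𝕜 := ℝ) i).continuous.comp (continuous_proj W)
    exact (continuous_const.mul (hi.div_const R).abs).measurable
  · exact sub_nonneg.mpr ((hPx x).1.trans (hPx x).2.1)
  · have h1 := (hPx x).2.2
    have h2 := hgap (proj W x)
    have h3 : 4 * (ε / (16 * s)) = ε / (4 * s) := by field_simp; norm_num
    rw [h3] at h1
    have h4 : (proj W ⁻¹' (Metric.thickening ρ A ∩ Metric.thickening ρ Aᶜ)).indicator
        (fun _ => (2 : ℝ)) x =
        (Metric.thickening ρ A ∩ Metric.thickening ρ Aᶜ).indicator (fun _ => 2) (proj W x) := rfl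
    rw [h4]
    linarith

end Sandwiching

/-! ### Choice of the parameters -/

section Parameters

/-- Concepts of intrinsic dimension zero are constant, hence are their own sandwiching
polynomials. -/
theorem exists_isSandwiching_of_intrinsicDim_zero {d : ℕ} {f : E d → ℝ} (hf : HasIntrinsicDim 0 f)
    (D : Measure (E d)) {ε : ℝ} (s : ℝ) :
    ∃ pUp pDown : MvPolynomial (Fin d) ℝ, IsSandwiching f D ε s 0 pUp pDown ∧
      coefSum pUp ≤ 1 ∧ coefSum pDown ≤ 1 := by
  obtain ⟨G, W, hG, -, hfG⟩ := hf
  have hconst : ∀ x, f x = G 0 := fun x => by rw [hfG, Subsingleton.elim (WithLp.toLp 2 _) 0]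
  have hc : coefSum (MvPolynomial.C (G 0) : MvPolynomial (Fin d) ℝ) ≤ 1 := by
    refine (coefSum_C_le _).trans ?_
    rcases hG 0 with h | h <;> simp [h]
  refine ⟨MvPolynomial.C (G 0), MvPolynomial.C (G 0), ⟨by simp, by simp, fun x => ?_, fun x => ?_,
    by simp⟩, hc, hc⟩ <;> simp [evalAt, hconst]

theorem classSandwichingDegree_le {d : ℕ} {F : Set (E d → ℝ)} {D : Measure (E d)} {ε s : ℝ} {ℓ : ℕ}
    (h : ∀ f ∈ F, ∃ pUp pDown, IsSandwiching f D ε s ℓ pUp pDown) :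
    classSandwichingDegree F D ε s ≤ ℓ :=
  iSup₂_le fun f hf => iInf₂_le ℓ (h f hf)

/-- Elementary bounds on the quantity `X` in terms of its ingredients. In particular `s` is
logarithmic in `X`, because `X ≥ 2 ^ s`. -/
theorem parameter_bounds {k : ℕ} {σ ε s X : ℝ} (hk : 1 ≤ k) (hσ : 1 ≤ σ) (hε : 0 < ε) (hε1 : ε < 1)
    (hs : 1 ≤ s) (hX : X = σ * (k : ℝ) ^ (3 / 2 : ℝ) * s / (ε / 2) ^ (s + 1)) :
    k * s / ε ≤ X ∧ (k : ℝ) ≤ X ∧ s ≤ 2 * Real.log (2 + X) ∧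
      4 * σ / (ε / 2) ^ s * √k = 2 * (ε / s) * (X / k) := by
  have hk1 : (1 : ℝ) ≤ k := by exact_mod_cast hk
  have hs0 : 0 < s := by linarith
  have hpow : (k : ℝ) ^ (3 / 2 : ℝ) = k * √k := by
    rw [Real.sqrt_eq_rpow, show (3 / 2 : ℝ) = 1 + 1 / 2 by norm_num,
      Real.rpow_add (by linarith), Real.rpow_one]
  have hsqrt : 1 ≤ √(k : ℝ) := Real.one_le_sqrt.mpr hk1
  have hεs : 0 < (ε / 2) ^ s := Real.rpow_pos_of_pos (by positivity) s
  have hsplit : (ε / 2) ^ (s + 1) = (ε / 2) ^ s * (ε / 2) := by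
    rw [Real.rpow_add (by positivity), Real.rpow_one]
  have hεs1 : (ε / 2) ^ s ≤ 1 := Real.rpow_le_one (by positivity) (by linarith) hs0.le
  have hnum : k * s ≤ σ * (k * √k) * s := by
    have : (k : ℝ) ≤ σ * (k * √k) := by nlinarith [mul_le_mul hσ hsqrt zero_le_one (by linarith)]
    gcongr
  have hks : k * s / ε ≤ X := by
    rw [hX, hpow, hsplit]
    refine div_le_div₀ (by positivity) hnum (by positivity) ?_
    nlinarith
  have h1 : (k : ℝ) ≤ k * s / ε := by
    rw [le_div_iff₀ hε]
    exact mul_le_mul_of_nonneg_left (by linarith) (by linarith)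
  refine ⟨hks, h1.trans hks, ?_, ?_⟩
  · have h2 : (2 : ℝ) ^ s ≤ X := by
      have h3 : (ε / 2) ^ (s + 1) ≤ (1 / 2) ^ s := by
        rw [hsplit]
        calc (ε / 2) ^ s * (ε / 2) ≤ (ε / 2) ^ s * 1 := by gcongr; linarith
          _ = (ε / 2) ^ s := mul_one _
          _ ≤ _ := Real.rpow_le_rpow (by positivity) (by linarith) hs0.le
      have h4 : 1 ≤ σ * (k * √k) * s := by nlinarith
      calc (2 : ℝ) ^ s = 1 / (1 / 2) ^ s := by
            rw [one_div 2, Real.inv_rpow (by norm_num), one_div, inv_inv]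
        _ ≤ X := by
            rw [hX, hpow]
            exact div_le_div₀ (by linarith) h4 (Real.rpow_pos_of_pos (by positivity) _) h3
    have h5 : s * Real.log 2 ≤ Real.log (2 + X) := by
      rw [← Real.log_rpow (by norm_num)]
      exact Real.log_le_log (by positivity) (by linarith)
    nlinarith [Real.log_two_gt_d9]
  · rw [hX, hpow, hsplit]
    field_simp
    norm_num

/-- The choice of the scale `R` of the cube and of the degree `n` per coordinate. The equation
`n ≈ A X R / k` comes from Jackson's theorem. The tails have to beat a polynomial of degree `k n`
in `L^s`, which asks for `R ^ (1 + γ)` of the order `k n s ≈ X R s`; this leads to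
`R ≈ (X s) ^ (1 / γ)`. -/
theorem exists_scale_degree {α β : ℝ} (hα : 0 < α) (hβ : 0 < β) {k : ℕ} {σ γ ε s X C : ℝ}
    (hk : 1 ≤ k) (hσ : 1 ≤ σ) (hγ : 0 < γ) (hε : 0 < ε) (hε1 : ε < 1) (hs : 1 ≤ s)
    (hX : X = σ * (k : ℝ) ^ (3 / 2 : ℝ) * s / (ε / 2) ^ (s + 1))
    (hC : C = 96 * (145 + 16 * α) * (1 + 1 / β)) :
    ∃ (n : ℕ) (R : ℝ), 1 ≤ n ∧ 1 ≤ R ∧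
      2 * ((2 * (k * n) : ℕ) * s) ≤ β * (R / 12) ^ (1 + γ) ∧
      4 * σ / (ε / 2) ^ s * R * (√k * (4 / n)) ≤ ε / (16 * s) ∧
      3 * (k * (2⁻¹ ^ (2 * (k * n)) * (1 + α))) ≤ ε / (4 * s) ∧
      ((2 * (k * n) : ℕ) : ℝ) ≤ (C * X * Real.log (2 + X)) ^ (1 + 1 / γ) := by
  obtain ⟨hXks, hXk, hXs, hXeq⟩ := parameter_bounds hk hσ hε hε1 hs hX
  have hk1 : (1 : ℝ) ≤ k := by exact_mod_cast hk
  have hs0 : 0 < s := by linarith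
  have hX1 : 1 ≤ X := hk1.trans hXk
  set A : ℝ := 144 + 16 * α with hA
  set Y : ℝ := 48 * (A + 1) * (1 + 1 / β) * X * s with hY
  have hβ1 : 1 ≤ 1 + 1 / β := by linarith [one_div_pos.mpr hβ]
  have hXs1 : X ≤ X * s := le_mul_of_one_le_right (by linarith) hs
  have hYX : 48 * (A + 1) * X ≤ Y := by
    have h1 : 48 * (A + 1) * X ≤ 48 * (A + 1) * (X * s) := by gcongr
    have h2 : 48 * (A + 1) * (X * s) * 1 ≤ 48 * (A + 1) * (X * s) * (1 + 1 / β) := by gcongr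
    rw [hY]
    linarith
  have hY1 : 1 ≤ Y := by nlinarith
  have hY0 : 0 < Y := by linarith
  set R : ℝ := 12 * Y ^ (1 / γ) with hR
  have hYγ : 1 ≤ Y ^ (1 / γ) := Real.one_le_rpow hY1 (by positivity)
  have hR1 : 1 ≤ R := by linarith
  set n : ℕ := ⌈A * X * R / k⌉₊ with hn
  have hnlow : A * X * R / k ≤ n := Nat.le_ceil _
  have hn1 : 1 ≤ n := Nat.one_le_ceil_iff.mpr (by positivity)
  have hn0 : (0 : ℝ) < n := by exact_mod_cast hn1
  have hNlow : A * X * R ≤ k * n := by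
    rw [div_le_iff₀ (by positivity)] at hnlow
    linarith
  have hXR : X ≤ X * R := le_mul_of_one_le_right (by linarith) hR1
  have hNup : k * n ≤ (A + 1) * X * R := by
    have h1 : (n : ℝ) < A * X * R / k + 1 := Nat.ceil_lt_add_one (by positivity)
    have h2 : (k : ℝ) * n ≤ k * (A * X * R / k + 1) := by gcongr
    have h3 : (k : ℝ) * (A * X * R / k + 1) = A * X * R + k := by field_simp
    nlinarith
  refine ⟨n, R, hn1, hR1, ?_, ?_, ?_, ?_⟩
  · have h1 : R / 12 = Y ^ (1 / γ) := by rw [hR]; ring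
    have h2 : (Y ^ (1 / γ)) ^ (1 + γ) = Y ^ (1 / γ) * Y := by
      rw [← Real.rpow_mul hY0.le, ← Real.rpow_add_one hY0.ne']
      congr 1
      field_simp
    have h3 : 48 * (A + 1) * (X * s) ≤ β * Y := by
      have : β * Y = 48 * (A + 1) * (X * s) * (β + 1) := by rw [hY]; field_simp
      rw [this]
      exact le_mul_of_one_le_right (by positivity) (by linarith)
    rw [h1, h2]
    push_cast
    calc 2 * (2 * ((k : ℝ) * n) * s) ≤ 2 * (2 * ((A + 1) * X * R) * s) := by gcongr
      _ = 48 * (A + 1) * (X * s) * Y ^ (1 / γ) := by rw [hR]; ring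
      _ ≤ β * Y * Y ^ (1 / γ) := by gcongr
      _ = _ := by ring
  · have h1 : 4 * σ / (ε / 2) ^ s * R * (√k * (4 / n)) =
        (4 * σ / (ε / 2) ^ s * √k) * (R * (4 / n)) := by ring
    have h2 : 128 * (X / k) * R ≤ n := by
      refine le_trans ?_ hnlow
      have : A * X * R / k = A * (X / k) * R := by ring
      rw [this]
      gcongr
      linarith
    rw [h1, hXeq]
    calc 2 * (ε / s) * (X / k) * (R * (4 / n)) = ε / (16 * s) * (128 * (X / k) * R / n) := by
          field_simp; norm_num
      _ ≤ ε / (16 * s) * 1 := by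
          gcongr
          exact (div_le_one hn0).mpr h2
      _ = _ := mul_one _
  · have h1 : ((k * n : ℕ) : ℝ) ≤ 2 ^ (2 * (k * n)) := by
      have h2 : k * n ≤ 2 ^ (2 * (k * n)) :=
        Nat.lt_two_pow_self.le.trans (Nat.pow_le_pow_right (by norm_num) (by omega))
      exact_mod_cast h2
    have h3 : 16 * (1 + α) * (k * s / ε) ≤ 2 ^ (2 * (k * n)) := by
      refine le_trans ?_ h1
      push_cast
      refine le_trans ?_ hNlow
      calc 16 * (1 + α) * (k * s / ε) ≤ 16 * (1 + α) * X := by gcongr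
        _ ≤ A * X := by gcongr; linarith
        _ ≤ A * X * R := le_mul_of_one_le_right (by positivity) hR1
    have h4 : (0 : ℝ) < 2 ^ (2 * (k * n)) := by positivity
    have h5 : 16 * (1 + α) * k * s ≤ ε * 2 ^ (2 * (k * n)) := by
      have := mul_le_mul_of_nonneg_left h3 hε.le
      calc 16 * (1 + α) * k * s = ε * (16 * (1 + α) * (k * s / ε)) := by field_simp
        _ ≤ _ := this
    have h6 : 0 ≤ (1 + α) * k * s := by positivity
    rw [inv_pow, le_div_iff₀ (by positivity)]
    calc 3 * (k * ((2 ^ (2 * (k * n)))⁻¹ * (1 + α))) * (4 * s)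
        = 12 * (1 + α) * k * s / 2 ^ (2 * (k * n)) := by field_simp; norm_num
      _ ≤ ε := by
        rw [div_le_iff₀ h4]
        linarith
  · have h1 : Y ≤ C * X * Real.log (2 + X) := by
      calc Y = 48 * (A + 1) * (1 + 1 / β) * X * s := hY
        _ ≤ 48 * (A + 1) * (1 + 1 / β) * X * (2 * Real.log (2 + X)) := by gcongr
        _ = C * X * Real.log (2 + X) := by rw [hC, hA]; ring
    calc ((2 * (k * n) : ℕ) : ℝ) = 2 * (k * n) := by push_cast; ring
      _ ≤ 2 * ((A + 1) * X * R) := by gcongr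
      _ = 24 * (A + 1) * X * Y ^ (1 / γ) := by rw [hR]; ring
      _ ≤ Y * Y ^ (1 / γ) := by
        gcongr
        nlinarith
      _ = Y ^ (1 + 1 / γ) := by rw [Real.rpow_add hY0, Real.rpow_one]
      _ ≤ _ := Real.rpow_le_rpow hY0.le h1 (by positivity)

theorem log_pow_le_softO {ℓ d : ℕ} (hℓ : 1 ≤ ℓ) (hd : 1 ≤ d) {C : ℝ} (hC : 4 ≤ C) :
    Real.log ((36 * d : ℝ) ^ ℓ) ≤ softO C 1 ℓ * (1 + Real.log d) ^ 1 := by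
  have hd0 : (0 : ℝ) < d := by exact_mod_cast hd
  have hlogd : 0 ≤ Real.log d := Real.log_natCast_nonneg d
  have h36 : Real.log 36 ≤ 4 := by
    rw [Real.log_le_iff_le_exp (by norm_num)]
    have he := Real.exp_one_gt_d9
    calc (36 : ℝ) ≤ 2.7 ^ 4 := by norm_num
      _ ≤ Real.exp 1 ^ 4 := by gcongr; linarith
      _ = Real.exp 4 := by rw [← Real.exp_nat_mul]; norm_num
  have hlogℓ : 1 ≤ Real.log (2 + ℓ) := by
    rw [Real.le_log_iff_exp_le (by positivity)]
    have : (1 : ℝ) ≤ ℓ := by exact_mod_cast hℓ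
    linarith [Real.exp_one_lt_d9]
  rw [Real.log_pow, Real.log_mul (by norm_num) hd0.ne', softO, pow_one, pow_one]
  calc (ℓ : ℝ) * (Real.log 36 + Real.log d) ≤ ℓ * (4 * 1 * (1 + Real.log d)) := by
        gcongr; linarith
    _ ≤ ℓ * (C * Real.log (2 + ℓ) * (1 + Real.log d)) := by gcongr
    _ = _ := by ring

end Parameters

end Sandwich

/-- The exponent `c` of the logarithms is absolute; the factor `C` depends only on the tail
parameters `α`, `β`. -/
theorem theorem3p2 :
    ∃ c : ℕ, ∀ α β : ℝ, 0 < α → 0 < β → ∃ C : ℝ, 0 < C ∧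
      ∀ (d k : ℕ) (σ γ : ℝ) (D : MeasureTheory.Measure (Sandwich.E d))
        (F : Set (Sandwich.E d → ℝ)),
        MeasureTheory.IsProbabilityMeasure D →
        Sandwich.IsValidInstance F D k σ γ α β →
        ∀ ε s : ℝ, 0 < ε → ε < 1 → 1 ≤ s →
          ∃ (ℓ : ℕ) (B : ℝ),
            Sandwich.classSandwichingDegree F D ε s ≤ (ℓ : ℕ∞) ∧
            (ℓ : ℝ) ≤
              Sandwich.softO C c (σ * (k : ℝ) ^ (3 / 2 : ℝ) * s / (ε / 2) ^ (s + 1))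
                ^ (1 + 1 / γ) ∧
            0 < B ∧
            Real.log B ≤ Sandwich.softO C c (ℓ : ℝ) * (1 + Real.log (d : ℝ)) ^ c ∧
            ∀ f ∈ F, ∃ pUp pDown : MvPolynomial (Fin d) ℝ,
              Sandwich.IsSandwiching f D ε s ℓ pUp pDown ∧
              Sandwich.coefSum pUp ≤ B ∧ Sandwich.coefSum pDown ≤ B := by
  refine ⟨1, fun α β hα hβ => ⟨96 * (145 + 16 * α) * (1 + 1 / β), by positivity, ?_⟩⟩
  intro d k σ γ D F hD hF ε s hε hε1 hs
  rcases Nat.eq_zero_or_pos k with rfl | hk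
  · have h := fun f hf => Sandwich.exists_isSandwiching_of_intrinsicDim_zero
      (hF.intrinsic f hf) D (ε := ε) s
    refine ⟨0, 1, Sandwich.classSandwichingDegree_le fun f hf => ?_, ?_, one_pos, ?_, h⟩
    · obtain ⟨p, q, hpq, -, -⟩ := h f hf
      exact ⟨p, q, hpq⟩
    · simpa [Sandwich.softO] using Real.rpow_nonneg le_rfl _
    · simp [Sandwich.softO]
  · have hd : 1 ≤ d := le_trans hk hF.dim_le
    obtain ⟨n, R, hn, hR, hgrowth, hjackson, hsmall, hdeg⟩ :=
      Sandwich.exists_scale_degree hα hβ hk hF.one_le_sigma hF.gamma_pos hε hε1 hs rfl rfl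
    have h : ∀ f ∈ F, ∃ pUp pDown : MvPolynomial (Fin d) ℝ,
        Sandwich.IsSandwiching f D ε s (2 * (k * n)) pUp pDown ∧
        Sandwich.coefSum pUp ≤ (36 * d) ^ (2 * (k * n)) ∧
        Sandwich.coefSum pDown ≤ (36 * d) ^ (2 * (k * n)) := by
      intro f hf
      obtain ⟨G, W, hG, hW, hfG⟩ := hF.intrinsic f hf
      exact Sandwich.exists_isSandwiching hG hW hfG (hF.smooth f hf) hF.tails hα hβ hF.gamma_pos
        hF.one_le_sigma hε hε1 hs hk hd hn hR hgrowth hjackson hsmall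
    refine ⟨2 * (k * n), (36 * d) ^ (2 * (k * n)),
      Sandwich.classSandwichingDegree_le fun f hf => ?_, ?_, ?_, ?_, h⟩
    · obtain ⟨p, q, hpq, -, -⟩ := h f hf
      exact ⟨p, q, hpq⟩
    · simpa [Sandwich.softO] using hdeg
    · have : (0 : ℝ) < d := by exact_mod_cast hd
      positivity
    · refine Sandwich.log_pow_le_softO ?_ hd ?_
      · have := Nat.mul_pos hk hn
        omega
      · have : 0 < 1 / β := by positivity
        nlinarith
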